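/- Let $U\subseteq\mathbb R^n$ be open, let $a\in U$, and let $(A_{ij})$ be a real-analytic pseudo-Riemannian metric on $U$ (a symmetric, nondegenerate matrix of real-analytic functions on $U$) which is indefinite at $a$, for instance a Lorentzian metric with $n\ge 2$. Let $(a^{ij})$ be the inverse matrix of $(A_{ij})$. Geodesics $x(s)$, $0\le s\le 1$, are the solutions in $U$ of $$\frac{dx^i}{ds}=\sum_j a^{ij}p_j,\qquad \frac{dp_i}{ds}=-\frac12\sum_{j,k}\frac{\partial a^{jk}}{\partial x^i}p_jp_k .$$ The characteristic conoid with vertex $a$ is the locus of all bicharacteristics issuing from $a$ in $U$, i.e. of the geodesics with $x(0)=a$ and $\sum_{i,j} a^{ij}(a)p_i(0)p_j(0)=0$. A normal neighbourhood of $a$ is an open set $W\ni a$ each of whose points $x$ is joined to $a$ inside $W$ by exactly one geodesic. The world function $\Gamma(x)$, $x\in W$, is the square $I^2$ of the length $I=\int_0^1\sqrt{\sum A_{ij}\dot x^i\dot x^j}\,dt$ of that geodesic (so $\Gamma\le 0$ where $I$ is imaginary). Let $u:U\to\mathbb R$ be real-analytic and not identically zero near $a$. Suppose that $u$ vanishes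 on the characteristic conoid with vertex $a$ and satisfies $$\sum_{i,j=1}^n a^{ij}\,\partial_i u\,\partial_j u=4u\qquad\text{on } U.$$ Then $u$ is the world function: $a$ has a normal neighbourhood contained in $U$, and $u=\Gamma$ on every normal neighbourhood $W\subseteq U$ of $a$. In contrast, there are infinitely many pairwise distinct $C^1$ functions on $U$ that satisfy the same equation on $U$ and vanish on the conoid but are not real-analytic on $U$. -/

import Mathlib

namespace Conoid

/-- The contravariant components `a^{ij}` of the metric with covariant components `A_{ij}`. -/
noncomputable def contra {n : ℕ} (A : (Fin n → ℝ) → Matrix (Fin n) (Fin n) ℝ)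
    (x : Fin n → ℝ) : Matrix (Fin n) (Fin n) ℝ :=
  (A x)⁻¹

/-- The partial derivative `∂f/∂x^i` at `x`. -/
noncomputable def partialDeriv {n : ℕ} (i : Fin n) (f : (Fin n → ℝ) → ℝ) (x : Fin n → ℝ) : ℝ :=
  fderiv ℝ f x (Pi.single i 1)

/-- The quadratic form of the metric on tangent vectors, `∑ A_{ij}(x) v^i v^j`. -/
def Q {n : ℕ} (A : (Fin n → ℝ) → Matrix (Fin n) (Fin n) ℝ) (x v : Fin n → ℝ) : ℝ :=
  ∑ i, ∑ j, A x i j * v i * v j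

/-- The characteristic form (principal symbol) on covectors, `∑ a^{ij}(x) p_i p_j`. -/
noncomputable def charForm {n : ℕ} (A : (Fin n → ℝ) → Matrix (Fin n) (Fin n) ℝ)
    (x p : Fin n → ℝ) : ℝ :=
  ∑ i, ∑ j, contra A x i j * p i * p j

/-- `A` is a real-analytic pseudo-Riemannian metric on `U`: a symmetric, nondegenerate matrix of
real-analytic functions. -/
structure IsAnalyticMetricOn {n : ℕ} (A : (Fin n → ℝ) → Matrix (Fin n) (Fin n) ℝ)
    (U : Set (Fin n → ℝ)) : Prop where
  analytic : ∀ i j, AnalyticOnNhd ℝ (fun x => A x i j) U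
  symm : ∀ x ∈ U, (A x).IsSymm
  nondegenerate : ∀ x ∈ U, (A x).det ≠ 0

/-- The metric is indefinite at `a` (for instance Lorentzian). -/
def IsIndefiniteAt {n : ℕ} (A : (Fin n → ℝ) → Matrix (Fin n) (Fin n) ℝ)
    (a : Fin n → ℝ) : Prop :=
  (∃ v, Q A a v < 0) ∧ ∃ w, 0 < Q A a w

/-- A geodesic lying in `U`, with affine parameter `s ∈ [0,1]`, in Hamiltonian form:
`dx^i/ds = ½ ∂H/∂p_i = ∑ a^{ij} p_j` and `dp_i/ds = -½ ∂H/∂x^i`, where `H = ∑ a^{ij}(x) p_i p_j`.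
Derivatives at the end points are one-sided. -/
structure IsGeodesicIn {n : ℕ} (A : (Fin n → ℝ) → Matrix (Fin n) (Fin n) ℝ)
    (U : Set (Fin n → ℝ)) (x p : ℝ → Fin n → ℝ) : Prop where
  mem : ∀ s ∈ Set.Icc (0 : ℝ) 1, x s ∈ U
  position : ∀ s ∈ Set.Icc (0 : ℝ) 1,
    HasDerivWithinAt x (fun i => ∑ j, contra A (x s) i j * p s j) (Set.Icc 0 1) s
  momentum : ∀ s ∈ Set.Icc (0 : ℝ) 1,
    HasDerivWithinAt p (fun i => -(1 / 2) * partialDeriv i (fun y => charForm A y (p s)) (x s))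
      (Set.Icc 0 1) s

/-- The characteristic conoid in `U` with vertex `a`: the locus of all bicharacteristics issuing
from `a`, that is, of the geodesics in `U` whose initial momentum annihilates the characteristic
form. -/
def characteristicConoid {n : ℕ} (A : (Fin n → ℝ) → Matrix (Fin n) (Fin n) ℝ)
    (U : Set (Fin n → ℝ)) (a : Fin n → ℝ) : Set (Fin n → ℝ) :=
  {y | ∃ x p : ℝ → Fin n → ℝ, IsGeodesicIn A U x p ∧ x 0 = a ∧ charForm A a (p 0) = 0 ∧ x 1 = y}

/-- `u` satisfies `∑ a^{ij} ∂_i u ∂_j u = 4 u` on `U`. -/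
def SolvesOn {n : ℕ} (A : (Fin n → ℝ) → Matrix (Fin n) (Fin n) ℝ)
    (U : Set (Fin n → ℝ)) (u : (Fin n → ℝ) → ℝ) : Prop :=
  ∀ x ∈ U, ∑ i, ∑ j, contra A x i j * partialDeriv i u x * partialDeriv j u x = 4 * u x

/-- The square `I²` of the arc length `I = ∫₀¹ √Q dt` of a curve of constant causal character.
`Real.sqrt` vanishes on negative numbers, so for `Q ≥ 0` this is `(∫ √Q)²`, and for `Q ≤ 0`,
where `I` is imaginary, it is `-(∫ √(-Q))²`. Along a geodesic `Q` is constant. -/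
noncomputable def squaredLength {n : ℕ} (A : (Fin n → ℝ) → Matrix (Fin n) (Fin n) ℝ)
    (x : ℝ → Fin n → ℝ) : ℝ :=
  (∫ t in (0 : ℝ)..1, √(Q A (x t) (derivWithin x (Set.Icc 0 1) t))) ^ 2
    - (∫ t in (0 : ℝ)..1, √(-Q A (x t) (derivWithin x (Set.Icc 0 1) t))) ^ 2

/-- `W` is an open neighbourhood of `a` each of whose points is joined to `a`, inside `W`, by one
and only one geodesic. -/
structure IsNormalNhd {n : ℕ} (A : (Fin n → ℝ) → Matrix (Fin n) (Fin n) ℝ)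
    (a : Fin n → ℝ) (W : Set (Fin n → ℝ)) : Prop where
  isOpen : IsOpen W
  mem : a ∈ W
  exists_geodesic : ∀ y ∈ W, ∃ x p : ℝ → Fin n → ℝ, IsGeodesicIn A W x p ∧ x 0 = a ∧ x 1 = y
  unique : ∀ x p x' p' : ℝ → Fin n → ℝ, IsGeodesicIn A W x p → IsGeodesicIn A W x' p' →
    x 0 = a → x' 0 = a → x 1 = x' 1 → Set.EqOn x x' (Set.Icc 0 1)

open Classical in
/-- The world function with base point `a` in `W`: the squared length of the geodesic in `W` from
`a` to `y`. It is meant for normal neighbourhoods `W` and `y ∈ W`; it is `0` if there is no such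
geodesic. -/
noncomputable def worldFunction {n : ℕ} (A : (Fin n → ℝ) → Matrix (Fin n) (Fin n) ℝ)
    (W : Set (Fin n → ℝ)) (a y : Fin n → ℝ) : ℝ :=
  if h : ∃ x : ℝ → Fin n → ℝ, ∃ p : ℝ → Fin n → ℝ, IsGeodesicIn A W x p ∧ x 0 = a ∧ x 1 = y then
    squaredLength A h.choose
  else 0

end Conoid

namespace Conoid

open Set Filter Topology
open scoped ContDiff NNReal

variable {n : ℕ} {A : (Fin n → ℝ) → Matrix (Fin n) (Fin n) ℝ} {U : Set (Fin n → ℝ)}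
  {a : Fin n → ℝ} {u : (Fin n → ℝ) → ℝ}

/-! ### The inverse metric as a field of linear maps -/

/-! The 2-jet of `u` at `a` is found first and then propagated along geodesics.

A quadratic form that vanishes on the null cone of an indefinite form is a multiple of it
(`exists_eq_smul_of_vanishes_on_null`). Differentiating `u = 0` once along bicharacteristics at `a`
shows that the square of `grad u a`, as a linear form, vanishes on null vectors. It is thus a
multiple of the metric, and since it is semidefinite, `grad u a = 0`. Differentiating twice, the
Hessian at `a` is `c` times the metric. The differentiated eikonal equation then reads `(2c - 4)
grad u = o(1) grad u` near `a`, so for `c ≠ 2` the gradient, and with it `u`, would vanish near `a`.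
Hence `c = 2` (`hessian_vertex_raise`).

Along a geodesic `(x, p)` from `a`, the defect `w(s) = grad u (x s) - 2 s p(s)` satisfies a linear
equation singular at `s = 0`. The 2-jet makes its coefficients `O(s)`, so the singularity cancels
and Grönwall's inequality gives `w = 0` (`SolvesOn.grad_eq`). At `s = 1` the eikonal equation
becomes `u = ∑ a^{ij} p_i p_j`, which is conserved and equals the squared length.

Normal neighbourhoods come from the exponential map at `a`: on a small ball it is a Lipschitz-small
perturbation of the invertible map `raise A a` (`exists_exponential`). The non-analytic solutions
are `± φ(± u)` with `s φ'(s)² = φ(s)`, where `φ` vanishes below a positive threshold (`profile`). -/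

/-- Raising indices: the linear map `p ↦ ∑ a^{ij}(x) p_j` from covectors to vectors. -/
noncomputable def raise (A : (Fin n → ℝ) → Matrix (Fin n) (Fin n) ℝ) (x : Fin n → ℝ) :
    (Fin n → ℝ) →L[ℝ] (Fin n → ℝ) :=
  ∑ i, ∑ j, contra A x i j •
    (ContinuousLinearMap.proj (R := ℝ) (φ := fun _ : Fin n => ℝ) j).smulRight
      (Pi.single i (1 : ℝ) : Fin n → ℝ)

/-- The bilinear map `(q, r) ↦ (∑ ∂_i a^{jk}(x) q_j r_k)_i`. -/
noncomputable def force (A : (Fin n → ℝ) → Matrix (Fin n) (Fin n) ℝ) (x q r : Fin n → ℝ) :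
    Fin n → ℝ :=
  fun i => (fderiv ℝ (raise A) x (Pi.single i 1) q) ⬝ᵥ r

/-- The geodesic vector field on phase space. -/
noncomputable def hamiltonField (A : (Fin n → ℝ) → Matrix (Fin n) (Fin n) ℝ)
    (z : (Fin n → ℝ) × (Fin n → ℝ)) : (Fin n → ℝ) × (Fin n → ℝ) :=
  (raise A z.1 z.2, (-(1 / 2) : ℝ) • force A z.1 z.2 z.2)

theorem raise_apply (x p : Fin n → ℝ) (i : Fin n) :
    raise A x p i = ∑ j, contra A x i j * p j := by
  simp [raise, Finset.sum_apply, Pi.single_apply]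

theorem raise_eq_mulVec (x p : Fin n → ℝ) : raise A x p = Matrix.mulVec (A x)⁻¹ p := by
  ext i
  rw [raise_apply]
  rfl

theorem charForm_eq (x p : Fin n → ℝ) : charForm A x p = raise A x p ⬝ᵥ p := by
  simp only [charForm, dotProduct, raise_apply, Finset.sum_mul]
  exact Finset.sum_congr rfl fun i _ => Finset.sum_congr rfl fun j _ => by ring

theorem Q_eq (x v : Fin n → ℝ) : Q A x v = Matrix.mulVec (A x) v ⬝ᵥ v := by
  simp only [Q, Matrix.mulVec, dotProduct, Finset.sum_mul]
  exact Finset.sum_congr rfl fun i _ => Finset.sum_congr rfl fun j _ => by ring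

theorem IsAnalyticMetricOn.isUnit_det (hA : IsAnalyticMetricOn A U) {x : Fin n → ℝ}
    (hx : x ∈ U) : IsUnit (A x).det :=
  (hA.nondegenerate x hx).isUnit

theorem IsAnalyticMetricOn.mulVec_raise (hA : IsAnalyticMetricOn A U) {x : Fin n → ℝ}
    (hx : x ∈ U) (p : Fin n → ℝ) : Matrix.mulVec (A x) (raise A x p) = p := by
  rw [raise_eq_mulVec, Matrix.mulVec_mulVec, Matrix.mul_nonsing_inv _ (hA.isUnit_det hx),
    Matrix.one_mulVec]

theorem IsAnalyticMetricOn.raise_mulVec (hA : IsAnalyticMetricOn A U) {x : Fin n → ℝ}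
    (hx : x ∈ U) (v : Fin n → ℝ) : raise A x (Matrix.mulVec (A x) v) = v := by
  rw [raise_eq_mulVec, Matrix.mulVec_mulVec, Matrix.nonsing_inv_mul _ (hA.isUnit_det hx),
    Matrix.one_mulVec]

theorem dotProduct_mulVec_of_isSymm {M : Matrix (Fin n) (Fin n) ℝ} (hM : M.IsSymm)
    (p q : Fin n → ℝ) : Matrix.mulVec M p ⬝ᵥ q = Matrix.mulVec M q ⬝ᵥ p := by
  rw [dotProduct_comm, Matrix.dotProduct_mulVec, ← Matrix.mulVec_transpose, hM.eq]

theorem IsAnalyticMetricOn.raise_symm (hA : IsAnalyticMetricOn A U) {x : Fin n → ℝ}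
    (hx : x ∈ U) (p q : Fin n → ℝ) : raise A x p ⬝ᵥ q = raise A x q ⬝ᵥ p := by
  rw [raise_eq_mulVec, raise_eq_mulVec]
  refine dotProduct_mulVec_of_isSymm ?_ p q
  rw [Matrix.IsSymm, Matrix.transpose_nonsing_inv, (hA.symm x hx).eq]

theorem IsAnalyticMetricOn.Q_raise (hA : IsAnalyticMetricOn A U) {x : Fin n → ℝ}
    (hx : x ∈ U) (p : Fin n → ℝ) : Q A x (raise A x p) = charForm A x p := by
  rw [Q_eq, hA.mulVec_raise hx, charForm_eq, dotProduct_comm]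

/-! ### Smoothness -/

theorem analyticAt_det {M : (Fin n → ℝ) → Matrix (Fin n) (Fin n) ℝ} {x : Fin n → ℝ}
    (hM : ∀ i j, AnalyticAt ℝ (fun y => M y i j) x) : AnalyticAt ℝ (fun y => (M y).det) x := by
  simp only [Matrix.det_apply']
  refine Finset.analyticAt_fun_sum _ fun σ _ => ?_
  exact analyticAt_const.mul (Finset.analyticAt_fun_prod _ fun i _ => hM _ _)

/-- Cramer's rule: each entry is a quotient of determinants of analytic matrices, with nonvanishing
denominator. -/
theorem IsAnalyticMetricOn.analyticAt_contra (hA : IsAnalyticMetricOn A U) {x : Fin n → ℝ}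
    (hx : x ∈ U) (i j : Fin n) : AnalyticAt ℝ (fun y => contra A y i j) x := by
  simp only [contra, Matrix.inv_def, Matrix.smul_apply, Ring.inverse_eq_inv', smul_eq_mul,
    Matrix.adjugate_apply]
  refine ((analyticAt_det fun i j => hA.analytic i j x hx).inv (hA.nondegenerate x hx)).mul ?_
  refine analyticAt_det fun k l => ?_
  by_cases hk : k = j
  · subst hk
    simpa using analyticAt_const
  · simpa [Matrix.updateRow_ne hk] using hA.analytic k l x hx

theorem IsAnalyticMetricOn.contDiffAt_raise (hA : IsAnalyticMetricOn A U) {x : Fin n → ℝ}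
    (hx : x ∈ U) : ContDiffAt ℝ ∞ (raise A) x := by
  unfold raise
  exact ContDiffAt.sum fun i _ => ContDiffAt.sum fun j _ =>
    (hA.analyticAt_contra hx i j).contDiffAt.smul contDiffAt_const

theorem IsAnalyticMetricOn.contDiffAt_fderiv_raise (hA : IsAnalyticMetricOn A U)
    {x : Fin n → ℝ} (hx : x ∈ U) : ContDiffAt ℝ ∞ (fderiv ℝ (raise A)) x :=
  (hA.contDiffAt_raise hx).fderiv_right (by simp)

theorem IsAnalyticMetricOn.continuousAt_norm_fderiv_raise (hA : IsAnalyticMetricOn A U)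
    {x : Fin n → ℝ} (hx : x ∈ U) : ContinuousAt (fun y => ‖fderiv ℝ (raise A) y‖) x :=
  (continuous_norm (E := (Fin n → ℝ) →L[ℝ] (Fin n → ℝ) →L[ℝ] (Fin n → ℝ))).continuousAt.comp
    (hA.contDiffAt_fderiv_raise hx).continuousAt

theorem IsAnalyticMetricOn.hasFDerivAt_raise (hA : IsAnalyticMetricOn A U) {x : Fin n → ℝ}
    (hx : x ∈ U) : HasFDerivAt (raise A) (fderiv ℝ (raise A) x) x :=
  ((hA.contDiffAt_raise hx).differentiableAt (by simp)).hasFDerivAt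

theorem IsAnalyticMetricOn.contDiffAt_hamiltonField (hA : IsAnalyticMetricOn A U)
    {z : (Fin n → ℝ) × (Fin n → ℝ)} (hz : z.1 ∈ U) : ContDiffAt ℝ ∞ (hamiltonField A) z := by
  have h1 : ContDiffAt ℝ ∞ (fun z : (Fin n → ℝ) × (Fin n → ℝ) => raise A z.1) z :=
    (hA.contDiffAt_raise hz).comp z contDiffAt_fst
  have h2 : ContDiffAt ℝ ∞ (fun z : (Fin n → ℝ) × (Fin n → ℝ) => fderiv ℝ (raise A) z.1) z :=
    (hA.contDiffAt_fderiv_raise hz).comp z contDiffAt_fst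
  refine (h1.clm_apply contDiffAt_snd).prodMk ((?_ : ContDiffAt ℝ ∞ (fun z : (Fin n → ℝ) × (Fin n → ℝ) =>
    force A z.1 z.2 z.2) z).const_smul _)
  refine contDiffAt_pi.2 fun i => ?_
  change ContDiffAt ℝ ∞ (fun z : (Fin n → ℝ) × (Fin n → ℝ) =>
    ∑ k, fderiv ℝ (raise A) z.1 (Pi.single i 1) z.2 k * z.2 k) z
  refine ContDiffAt.sum fun k _ => ?_
  have h3 := (h2.clm_apply (contDiffAt_const (c := Pi.single i (1 : ℝ)))).clm_apply
    contDiffAt_snd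
  exact (contDiffAt_pi.1 h3 k).mul (contDiffAt_pi.1 contDiffAt_snd k)

/-- The derivative of `v ⬝ᵥ w` along a curve. -/
theorem hasFDerivAt_dotProduct {F : Type*} [NormedAddCommGroup F] [NormedSpace ℝ F]
    {v w : F → Fin n → ℝ} {v' w' : F →L[ℝ] (Fin n → ℝ)} {x : F}
    (hv : HasFDerivAt v v' x) (hw : HasFDerivAt w w' x) :
    ∃ L : F →L[ℝ] ℝ, HasFDerivAt (fun y => v y ⬝ᵥ w y) L x ∧
      ∀ e, L e = v' e ⬝ᵥ w x + v x ⬝ᵥ w' e := by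
  refine ⟨_, HasFDerivAt.fun_sum fun i _ => ((hasFDerivAt_pi'.1 hv i).mul (hasFDerivAt_pi'.1 hw i)),
    fun e => ?_⟩
  simp [dotProduct, Finset.sum_add_distrib, mul_comm, add_comm]

theorem hasDerivWithinAt_dotProduct {v w : ℝ → Fin n → ℝ} {v' w' : Fin n → ℝ} {s : Set ℝ} {t : ℝ}
    (hv : HasDerivWithinAt v v' s t) (hw : HasDerivWithinAt w w' s t) :
    HasDerivWithinAt (fun y => v y ⬝ᵥ w y) (v' ⬝ᵥ w t + v t ⬝ᵥ w') s t := by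
  have := HasDerivWithinAt.fun_sum (u := Finset.univ) fun i _ =>
    (hasDerivWithinAt_pi.1 hv i).mul (hasDerivWithinAt_pi.1 hw i)
  refine this.congr_deriv ?_
  simp only [dotProduct, Finset.sum_add_distrib]

theorem IsAnalyticMetricOn.partialDeriv_charForm (hA : IsAnalyticMetricOn A U) {x : Fin n → ℝ}
    (hx : x ∈ U) (p : Fin n → ℝ) (i : Fin n) :
    partialDeriv i (fun y => charForm A y p) x = force A x p p i := by
  have h1 : HasFDerivAt (fun y => raise A y p) ((fderiv ℝ (raise A) x).flip p) x := by
    simpa using (hA.hasFDerivAt_raise hx).clm_apply (hasFDerivAt_const p x)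
  obtain ⟨L, hL, hLe⟩ := hasFDerivAt_dotProduct h1 (hasFDerivAt_const p x)
  simp only [partialDeriv, charForm_eq]
  rw [hL.fderiv, hLe]
  simp [force]

/-! ### Estimates for `force` -/

/-- The factor `n` appears because vectors carry the sup norm. -/
theorem abs_dotProduct_le (v w : Fin n → ℝ) : |v ⬝ᵥ w| ≤ n * (‖v‖ * ‖w‖) := by
  calc |v ⬝ᵥ w| ≤ ∑ i, |v i * w i| := Finset.abs_sum_le_sum_abs _ _
    _ ≤ ∑ _i : Fin n, ‖v‖ * ‖w‖ := by
        refine Finset.sum_le_sum fun i _ => ?_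
        rw [abs_mul]
        exact mul_le_mul (norm_le_pi_norm v i) (norm_le_pi_norm w i) (abs_nonneg _)
          (norm_nonneg _)
    _ = n * (‖v‖ * ‖w‖) := by simp

theorem norm_force_le (x q r : Fin n → ℝ) :
    ‖force A x q r‖ ≤ n * ‖fderiv ℝ (raise A) x‖ * ‖q‖ * ‖r‖ := by
  refine (pi_norm_le_iff_of_nonneg (by positivity)).2 fun i => ?_
  refine (abs_dotProduct_le _ _).trans ?_
  have h1 : ‖(Pi.single i 1 : Fin n → ℝ)‖ ≤ 1 := by
    rw [Pi.norm_single, norm_one]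
  have h2 : ‖fderiv ℝ (raise A) x (Pi.single i 1) q‖ ≤ ‖fderiv ℝ (raise A) x‖ * ‖q‖ := by
    refine (ContinuousLinearMap.le_opNorm _ _).trans ?_
    gcongr
    exact ((fderiv ℝ (raise A) x).le_opNorm _).trans (mul_le_of_le_one_right (norm_nonneg _) h1)
  calc (n : ℝ) * (‖fderiv ℝ (raise A) x (Pi.single i 1) q‖ * ‖r‖)
      ≤ n * ((‖fderiv ℝ (raise A) x‖ * ‖q‖) * ‖r‖) := by gcongr
    _ = _ := by ring

theorem force_sub_left (x q q' r : Fin n → ℝ) :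
    force A x (q - q') r = force A x q r - force A x q' r := by
  ext i
  simp [force, sub_dotProduct]

theorem force_sub_right (x q r r' : Fin n → ℝ) :
    force A x q (r - r') = force A x q r - force A x q r' := by
  ext i
  simp [force, dotProduct_sub]

/-- This homogeneity makes `s ↦ (x (t s), t p (t s))` a geodesic whenever `(x, p)` is one. -/
theorem force_smul_smul (t : ℝ) (x q r : Fin n → ℝ) :
    force A x (t • q) (t • r) = t ^ 2 • force A x q r := by
  ext i
  simp [force, smul_dotProduct, dotProduct_smul]
  ring

theorem hasDerivWithinAt_fst {F G : Type*} [NormedAddCommGroup F] [NormedSpace ℝ F]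
    [NormedAddCommGroup G] [NormedSpace ℝ G] {z : ℝ → F × G} {z' : F × G} {s : Set ℝ} {t : ℝ}
    (h : HasDerivWithinAt z z' s t) : HasDerivWithinAt (fun t => (z t).1) z'.1 s t :=
  (ContinuousLinearMap.fst ℝ F G).hasFDerivAt.comp_hasDerivWithinAt t h

theorem hasDerivWithinAt_snd {F G : Type*} [NormedAddCommGroup F] [NormedSpace ℝ F]
    [NormedAddCommGroup G] [NormedSpace ℝ G] {z : ℝ → F × G} {z' : F × G} {s : Set ℝ} {t : ℝ}
    (h : HasDerivWithinAt z z' s t) : HasDerivWithinAt (fun t => (z t).2) z'.2 s t :=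
  (ContinuousLinearMap.snd ℝ F G).hasFDerivAt.comp_hasDerivWithinAt t h

/-! ### Geodesics as integral curves in phase space -/

theorem IsGeodesicIn.mono {W V : Set (Fin n → ℝ)} {x p : ℝ → Fin n → ℝ}
    (h : IsGeodesicIn A W x p) (hWV : W ⊆ V) : IsGeodesicIn A V x p :=
  ⟨fun s hs => hWV (h.mem s hs), h.position, h.momentum⟩

theorem IsGeodesicIn.of_mem {W V : Set (Fin n → ℝ)} {x p : ℝ → Fin n → ℝ}
    (h : IsGeodesicIn A W x p) (hV : ∀ s ∈ Icc (0 : ℝ) 1, x s ∈ V) : IsGeodesicIn A V x p :=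
  ⟨hV, h.position, h.momentum⟩

/-- Gives access to existence and uniqueness theory for a single autonomous equation on phase space.
-/
theorem IsAnalyticMetricOn.isGeodesicIn_iff (hA : IsAnalyticMetricOn A U)
    {x p : ℝ → Fin n → ℝ} :
    IsGeodesicIn A U x p ↔ ∀ s ∈ Icc (0 : ℝ) 1, x s ∈ U ∧
      HasDerivWithinAt (fun s => (x s, p s)) (hamiltonField A (x s, p s)) (Icc 0 1) s := by
  have key : ∀ s, x s ∈ U →
      hamiltonField A (x s, p s) = ((fun i => ∑ j, contra A (x s) i j * p s j),
        fun i => -(1 / 2) * partialDeriv i (fun y => charForm A y (p s)) (x s)) := by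
    intro s hs
    refine Prod.ext (funext fun i => raise_apply _ _ i) (funext fun i => ?_)
    exact congrArg (fun y => -(1 / 2 : ℝ) * y) (hA.partialDeriv_charForm hs _ i).symm
  constructor
  · intro h s hs
    refine ⟨h.mem s hs, ?_⟩
    rw [key s (h.mem s hs)]
    exact (h.position s hs).prodMk (h.momentum s hs)
  · intro h
    refine ⟨fun s hs => (h s hs).1, fun s hs => ?_, fun s hs => ?_⟩
    · have := (h s hs).2
      rw [key s (h s hs).1] at this
      exact hasDerivWithinAt_fst this
    · have := (h s hs).2
      rw [key s (h s hs).1] at this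
      exact hasDerivWithinAt_snd this

section Geodesic

variable {x p : ℝ → Fin n → ℝ}

theorem IsGeodesicIn.hasDerivWithinAt_position (h : IsGeodesicIn A U x p)
    {s : ℝ} (hs : s ∈ Icc (0 : ℝ) 1) :
    HasDerivWithinAt x (raise A (x s) (p s)) (Icc 0 1) s := by
  convert h.position s hs using 1
  exact funext fun i => raise_apply _ _ i

theorem IsGeodesicIn.hasDerivWithinAt_momentum (hA : IsAnalyticMetricOn A U)
    (h : IsGeodesicIn A U x p) {s : ℝ} (hs : s ∈ Icc (0 : ℝ) 1) :
    HasDerivWithinAt p ((-(1 / 2) : ℝ) • force A (x s) (p s) (p s)) (Icc 0 1) s :=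
  hasDerivWithinAt_snd ((hA.isGeodesicIn_iff.1 h) s hs).2

theorem IsGeodesicIn.continuousOn_position (h : IsGeodesicIn A U x p) :
    ContinuousOn x (Icc 0 1) :=
  fun _ hs => (h.position _ hs).continuousWithinAt

theorem IsGeodesicIn.continuousOn_momentum (h : IsGeodesicIn A U x p) :
    ContinuousOn p (Icc 0 1) :=
  fun _ hs => (h.momentum _ hs).continuousWithinAt

end Geodesic

theorem hasDerivWithinAt_Ici_of_Icc {F : Type*} [NormedAddCommGroup F] [NormedSpace ℝ F]
    {f : ℝ → F} {f' : F} {s : ℝ} (h : HasDerivWithinAt f f' (Icc (0 : ℝ) 1) s)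
    (hs : s ∈ Ico (0 : ℝ) 1) : HasDerivWithinAt f f' (Ici s) s :=
  h.mono_of_mem_nhdsWithin (mem_of_superset (Icc_mem_nhdsGE hs.2) (Icc_subset_Icc_left hs.1))

/-- Geodesics with the same initial data coincide. -/
theorem IsGeodesicIn.eqOn (hA : IsAnalyticMetricOn A U) {x p x' p' : ℝ → Fin n → ℝ}
    (h : IsGeodesicIn A U x p) (h' : IsGeodesicIn A U x' p') (hx : x 0 = x' 0)
    (hp : p 0 = p' 0) : ∀ s ∈ Icc (0 : ℝ) 1, x s = x' s ∧ p s = p' s := by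
  have c1 : ContinuousOn (fun s => (x s, p s)) (Icc 0 1) :=
    h.continuousOn_position.prodMk h.continuousOn_momentum
  have c2 : ContinuousOn (fun s => (x' s, p' s)) (Icc 0 1) :=
    h'.continuousOn_position.prodMk h'.continuousOn_momentum
  -- The field is only locally Lipschitz; on the compact union of the two traces one constant
  -- suffices.
  set S := (fun s => (x s, p s)) '' Icc (0 : ℝ) 1 ∪ (fun s => (x' s, p' s)) '' Icc (0 : ℝ) 1
    with hS
  have hSc : IsCompact S := (isCompact_Icc.image_of_continuousOn c1).union
    (isCompact_Icc.image_of_continuousOn c2)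
  have hl : LocallyLipschitzOn S (hamiltonField A) := by
    intro z hz
    have hzU : z.1 ∈ U := by
      rcases hz with ⟨s, hs, rfl⟩ | ⟨s, hs, rfl⟩
      exacts [h.mem s hs, h'.mem s hs]
    obtain ⟨K, t, ht, hK⟩ :=
      ((hA.contDiffAt_hamiltonField hzU).of_le (m := 1) (by simp)).exists_lipschitzOnWith
    exact ⟨K, t, mem_nhdsWithin_of_mem_nhds ht, hK⟩
  obtain ⟨K, hK⟩ := hl.exists_lipschitzOnWith_of_compact hSc
  have := ODE_solution_unique_of_mem_Icc_right (v := fun _ => hamiltonField A) (s := fun _ => S)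
    (a := 0) (b := 1) (fun _ _ => hK) c1
    (fun s hs => hasDerivWithinAt_Ici_of_Icc
      ((hA.isGeodesicIn_iff.1 h) s (Ico_subset_Icc_self hs)).2 hs)
    (fun s hs => Or.inl ⟨s, Ico_subset_Icc_self hs, rfl⟩) c2
    (fun s hs => hasDerivWithinAt_Ici_of_Icc
      ((hA.isGeodesicIn_iff.1 h') s (Ico_subset_Icc_self hs)).2 hs)
    (fun s hs => Or.inr ⟨s, Ico_subset_Icc_self hs, rfl⟩) (by simp [hx, hp])
  exact fun s hs => by simpa using this hs

/-- Reparametrization of an integral curve of the geodesic field. -/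
theorem hasDerivWithinAt_hamiltonField_comp_mul {z : ℝ → (Fin n → ℝ) × (Fin n → ℝ)} {τ T s : ℝ}
    (hτ : 0 ≤ τ) (hT : τ ≤ T)
    (h : HasDerivWithinAt z (hamiltonField A (z (τ * s))) (Icc 0 T) (τ * s)) :
    HasDerivWithinAt (fun s => ((z (τ * s)).1, τ • (z (τ * s)).2))
      (hamiltonField A ((z (τ * s)).1, τ • (z (τ * s)).2)) (Icc 0 1) s := by
  have hm : MapsTo (fun s : ℝ => τ * s) (Icc 0 1) (Icc 0 T) := fun t ht =>
    ⟨mul_nonneg hτ ht.1, (mul_le_of_le_one_right hτ ht.2).trans hT⟩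
  have h1 := h.scomp s (((hasDerivAt_id s).const_mul τ).hasDerivWithinAt) hm
  simp only [mul_one] at h1
  refine ((hasDerivWithinAt_fst h1).prodMk ((hasDerivWithinAt_snd h1).const_smul τ)).congr_deriv ?_
  refine Prod.ext ?_ ?_
  · simp [hamiltonField]
  · simp [hamiltonField, force_smul_smul, smul_smul]
    ring_nf

/-- Rescaling of a geodesic. -/
theorem IsGeodesicIn.comp_mul (hA : IsAnalyticMetricOn A U) {x p : ℝ → Fin n → ℝ}
    (h : IsGeodesicIn A U x p) {τ : ℝ} (hτ : τ ∈ Icc (0 : ℝ) 1) :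
    IsGeodesicIn A U (fun s => x (τ * s)) (fun s => τ • p (τ * s)) := by
  refine hA.isGeodesicIn_iff.2 fun s hs => ?_
  have hm : τ * s ∈ Icc (0 : ℝ) 1 := ⟨mul_nonneg hτ.1 hs.1, mul_le_one₀ hτ.2 hs.1 hs.2⟩
  have h1 := hA.isGeodesicIn_iff.1 h (τ * s) hm
  exact ⟨h1.1, hasDerivWithinAt_hamiltonField_comp_mul (z := fun s => (x s, p s))
    hτ.1 hτ.2 h1.2⟩

/-! ### Existence of geodesics and the exponential map -/

/-- Picard-Lindelöf, together with the information that the solution stays in the ball. -/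
theorem exists_solution_mem_closedBall {F : Type*} [NormedAddCommGroup F] [NormedSpace ℝ F]
    [CompleteSpace F] {f : ℝ → F → F} {tmin tmax : ℝ} {t₀ : Icc tmin tmax} {x₀ x : F}
    {b r L K : ℝ≥0} (hf : IsPicardLindelof f t₀ x₀ b r L K) (hx : x ∈ Metric.closedBall x₀ r) :
    ∃ α : ℝ → F, α t₀ = x ∧
      (∀ t ∈ Icc tmin tmax, HasDerivWithinAt α (f t (α t)) (Icc tmin tmax) t) ∧
      ∀ t, α t ∈ Metric.closedBall x₀ b := by
  obtain ⟨α, hα⟩ := ODE.FunSpace.exists_isFixedPt_next hf hx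
  refine ⟨α.compProj, by rw [ODE.FunSpace.compProj_val, ← hα, ODE.FunSpace.next_apply₀],
    fun t ht => ?_, fun t => α.compProj_mem_closedBall hf.mul_max_le⟩
  apply ODE.hasDerivWithinAt_picard_Icc t₀.2 hf.continuousOn_uncurry
    α.continuous_compProj.continuousOn (fun _ _ => α.compProj_mem_closedBall hf.mul_max_le)
    x ht |>.congr_of_mem _ ht
  intro t' ht'
  nth_rw 1 [← hα]
  rw [ODE.FunSpace.compProj_of_mem ht', ODE.FunSpace.next_apply]

/-- Geodesics with small initial momentum exist up to time one and stay near `(a, 0)`. -/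
theorem IsAnalyticMetricOn.exists_geodesic (hA : IsAnalyticMetricOn A U) (hU : IsOpen U)
    (ha : a ∈ U) {ρ : ℝ} (hρ : 0 < ρ) :
    ∃ δ > 0, ∀ q : Fin n → ℝ, ‖q‖ ≤ δ → ∃ x p : ℝ → Fin n → ℝ, IsGeodesicIn A U x p ∧
      x 0 = a ∧ p 0 = q ∧
      ∀ s ∈ Icc (0 : ℝ) 1, (x s, p s) ∈ Metric.closedBall (a, (0 : Fin n → ℝ)) ρ := by
  obtain ⟨η, hη, hηU⟩ := Metric.isOpen_iff.1 hU a ha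
  obtain ⟨ε, hε, b, r, L, K, hr, hPL⟩ := IsPicardLindelof.of_contDiffAt_one
    ((hA.contDiffAt_hamiltonField (z := (a, (0 : Fin n → ℝ))) ha).of_le (m := 1) (by simp))
  have hPL0 := hPL 0
  have hb : (0 : ℝ) < b := by
    have h1 := hPL0.mul_max_le
    have h2 : (0 : ℝ) ≤ L * max (0 + ε - 0) (0 - (0 - ε)) := by
      have : (0 : ℝ) ≤ max (0 + ε - 0) (0 - (0 - ε)) := le_max_of_le_left (by linarith)
      positivity
    have h3 : (0 : ℝ) < r := hr
    exact h3.trans_le (by linarith [h2.trans h1])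
  -- The radius `b` keeps the Picard–Lindelöf bounds, `ρ` the requested closeness, and `η / 2` keeps
  -- the curve inside `U`.
  set c : ℝ≥0 := min b (min ρ.toNNReal (η / 2).toNNReal) with hc
  have hc0 : 0 < c := lt_min hb (lt_min (by simpa using hρ) (by simpa using hη))
  have hcρ : (c : ℝ) ≤ ρ := by
    have : c ≤ ρ.toNNReal := (min_le_right _ _).trans (min_le_left _ _)
    simpa [hρ.le] using NNReal.coe_le_coe.2 this
  have hcη : (c : ℝ) < η := by
    have : c ≤ (η / 2).toNNReal := (min_le_right _ _).trans (min_le_right _ _)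
    have h2 : (c : ℝ) ≤ η / 2 := by
      have := NNReal.coe_le_coe.2 this
      rwa [Real.coe_toNNReal _ (by linarith)] at this
    linarith
  obtain ⟨ε', hε', hPL'⟩ := hPL0.exists_shrink_radius hε (a' := c) (r' := c / 2)
    (min_le_left _ _) (half_lt_self hc0)
  set T : ℝ := min ε' 1 with hT
  have hT0 : 0 < T := lt_min hε' one_pos
  have hT1 : T ≤ 1 := min_le_right _ _
  have hTε : T ≤ ε' := min_le_left _ _
  -- The flow starts from momentum `q / T`, runs for the short time `T`, and is rescaled to `[0,1]`,
  -- which restores the momentum `q`.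
  refine ⟨T * (c / 2), by positivity, fun q hq => ?_⟩
  have hq' : (a, T⁻¹ • q) ∈ Metric.closedBall (a, (0 : Fin n → ℝ)) ((c / 2 : ℝ≥0) : ℝ) := by
    rw [Metric.mem_closedBall, Prod.dist_eq, dist_self, dist_zero_right, norm_smul, norm_inv,
      Real.norm_of_nonneg hT0.le]
    refine max_le (by positivity) ?_
    rw [inv_mul_le_iff₀ hT0]
    simpa using hq
  obtain ⟨z, hz0, hz, hzb⟩ := exists_solution_mem_closedBall hPL' hq'
  have hz0' : z 0 = (a, T⁻¹ • q) := hz0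
  have hball : ∀ t, (z t).1 ∈ U := fun t => by
    refine hηU (lt_of_le_of_lt ?_ hcη)
    have := hzb t
    rw [Metric.mem_closedBall, Prod.dist_eq] at this
    exact (le_max_left _ _).trans this
  refine ⟨fun s => (z (T * s)).1, fun s => T • (z (T * s)).2, hA.isGeodesicIn_iff.2 fun s hs =>
    ⟨hball _, ?_⟩, by simp [hz0'], by simp [hz0', hT0.ne'], fun s hs => ?_⟩
  · have hm : T * s ∈ Icc (0 : ℝ) T :=
      ⟨mul_nonneg hT0.le hs.1, mul_le_of_le_one_right hT0.le hs.2⟩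
    have hsub : Icc (0 : ℝ) T ⊆ Icc (0 - ε') (0 + ε') :=
      Icc_subset_Icc (by linarith) (by linarith)
    exact hasDerivWithinAt_hamiltonField_comp_mul hT0.le le_rfl ((hz _ (hsub hm)).mono hsub)
  · have := hzb (T * s)
    rw [Metric.mem_closedBall, Prod.dist_eq] at this ⊢
    refine max_le ((le_max_left _ _).trans (this.trans hcρ)) ?_
    have h2 := (le_max_right _ _).trans (this.trans hcρ)
    rw [dist_zero_right] at h2 ⊢
    rw [norm_smul, Real.norm_of_nonneg hT0.le]
    exact (mul_le_of_le_one_left (norm_nonneg _) hT1).trans h2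

/-- The linearization of the geodesic field at the stationary point `(a, 0)`. -/
theorem IsAnalyticMetricOn.hasStrictFDerivAt_hamiltonField (hA : IsAnalyticMetricOn A U)
    (ha : a ∈ U) :
    HasStrictFDerivAt (hamiltonField A)
      (((raise A a).comp (ContinuousLinearMap.snd ℝ (Fin n → ℝ) (Fin n → ℝ))).prod 0)
      (a, (0 : Fin n → ℝ)) := by
  refine (hA.contDiffAt_hamiltonField (z := (a, (0 : Fin n → ℝ))) ha).hasStrictFDerivAt'
    ?_ (by simp)
  have hfst : HasFDerivAt (fun z : (Fin n → ℝ) × (Fin n → ℝ) => z.1)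
    (ContinuousLinearMap.fst ℝ (Fin n → ℝ) (Fin n → ℝ)) (a, (0 : Fin n → ℝ)) := hasFDerivAt_fst
  have hsnd : HasFDerivAt (fun z : (Fin n → ℝ) × (Fin n → ℝ) => z.2)
    (ContinuousLinearMap.snd ℝ (Fin n → ℝ) (Fin n → ℝ)) (a, (0 : Fin n → ℝ)) := hasFDerivAt_snd
  refine HasFDerivAt.prodMk ?_ ?_
  · have h1 := HasFDerivAt.comp (g := raise A) (a, (0 : Fin n → ℝ))
      (hA.hasFDerivAt_raise (x := a) ha) hfst
    refine HasFDerivAt.congr_fderiv (h1.clm_apply hsnd) ?_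
    ext v <;> simp
  · rw [hasFDerivAt_pi']
    intro i
    have h1 := HasFDerivAt.comp (g := fderiv ℝ (raise A)) (a, (0 : Fin n → ℝ))
      ((hA.contDiffAt_fderiv_raise (x := a) ha).differentiableAt (by simp)).hasFDerivAt hfst
    obtain ⟨L, hL, hLe⟩ := hasFDerivAt_dotProduct
      ((h1.clm_apply (hasFDerivAt_const (Pi.single i (1 : ℝ) : Fin n → ℝ) _)).clm_apply hsnd) hsnd
    -- `force` is quadratic in the momentum, so its derivative vanishes at `p = 0`.
    have hL0 : L = 0 := by
      ext e <;> simp [hLe]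
    rw [hL0] at hL
    refine HasFDerivAt.congr_fderiv (hL.const_smul (-(1 / 2) : ℝ)) ?_
    ext e <;> simp

/-- Two geodesics issuing from `a` near `(a, 0)` differ at time one by almost the linear term. -/
theorem IsGeodesicIn.norm_sub_le (hA : IsAnalyticMetricOn A U)
    {S : Set ((Fin n → ℝ) × (Fin n → ℝ))} {κ : ℝ≥0} (hκ : κ ≤ 1)
    (hS : ApproximatesLinearOn (hamiltonField A)
      (((raise A a).comp (ContinuousLinearMap.snd ℝ (Fin n → ℝ) (Fin n → ℝ))).prod 0) S κ)
    {x p x' p' : ℝ → Fin n → ℝ} (h : IsGeodesicIn A U x p) (h' : IsGeodesicIn A U x' p')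
    (hx : x 0 = a) (hx' : x' 0 = a) (hm : ∀ s ∈ Icc (0 : ℝ) 1, (x s, p s) ∈ S)
    (hm' : ∀ s ∈ Icc (0 : ℝ) 1, (x' s, p' s) ∈ S) :
    ‖x 1 - x' 1 - raise A a (p 0 - p' 0)‖ ≤
      (‖raise A a‖ + 1) * (κ * (Real.exp (‖raise A a‖ + 1) * ‖p 0 - p' 0‖)) := by
  set D := ‖p 0 - p' 0‖ with hD
  set B := ‖raise A a‖ with hB
  have hB0 : 0 ≤ B := norm_nonneg _
  have hκ1 : (κ : ℝ) ≤ 1 := by exact_mod_cast hκ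
  set d : ℝ → (Fin n → ℝ) × (Fin n → ℝ) := fun s => (x s - x' s, p s - p' s) with hd
  -- The error of the linearization; `d' = (raise A a d.2, 0) + e` with `‖e‖ ≤ κ ‖d‖`.
  set e : ℝ → (Fin n → ℝ) × (Fin n → ℝ) := fun s =>
    hamiltonField A (x s, p s) - hamiltonField A (x' s, p' s) - (raise A a (p s - p' s), 0) with he
  have hd' : ∀ s ∈ Icc (0 : ℝ) 1,
      HasDerivWithinAt d ((raise A a (d s).2, 0) + e s) (Icc 0 1) s := by
    intro s hs
    have := ((hA.isGeodesicIn_iff.1 h) s hs).2.sub ((hA.isGeodesicIn_iff.1 h') s hs).2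
    refine this.congr_deriv ?_
    simp [he, hd]
  have hes : ∀ s ∈ Icc (0 : ℝ) 1, ‖e s‖ ≤ κ * ‖d s‖ := by
    intro s hs
    have := hS _ (hm s hs) _ (hm' s hs)
    simpa [he, hd] using this
  have hpn : ∀ v : Fin n → ℝ, ‖((raise A a v, 0) : (Fin n → ℝ) × (Fin n → ℝ))‖ ≤ B * ‖v‖ := by
    intro v
    rw [Prod.norm_def]
    simpa using (raise A a).le_opNorm v
  have hd0 : ‖d 0‖ = D := by
    simp [hd, hx, hx', Prod.norm_def, hD]
  have hbound : ∀ s ∈ Icc (0 : ℝ) 1, ‖d s‖ ≤ Real.exp (B + 1) * D := by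
    intro s hs
    have h1 := norm_le_gronwallBound_of_norm_deriv_right_le (f := d) (δ := D) (K := B + 1) (ε := 0)
      (a := 0) (b := 1) (fun s hs => (hd' s hs).continuousWithinAt)
      (fun s hs => hasDerivWithinAt_Ici_of_Icc (hd' s (Ico_subset_Icc_self hs)) hs) hd0.le
      (fun s hs => by
        have hs' := Ico_subset_Icc_self hs
        calc ‖((raise A a (d s).2, 0) + e s : (Fin n → ℝ) × (Fin n → ℝ))‖
            ≤ B * ‖(d s).2‖ + κ * ‖d s‖ := (norm_add_le _ _).trans (add_le_add (hpn _) (hes s hs'))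
          _ ≤ B * ‖d s‖ + 1 * ‖d s‖ := by
            gcongr
            exact norm_snd_le _
          _ = (B + 1) * ‖d s‖ + 0 := by ring) s hs
    rw [gronwallBound_ε0, sub_zero] at h1
    refine h1.trans ?_
    rw [mul_comm]
    gcongr
    nlinarith [hs.2]
  set C := Real.exp (B + 1) * D with hC
  have hC0 : 0 ≤ C := by positivity
  have heC : ∀ s ∈ Icc (0 : ℝ) 1, ‖e s‖ ≤ κ * C := fun s hs =>
    (hes s hs).trans (by gcongr; exact hbound s hs)
  -- The linear part has no momentum component, so the momentum difference moves only by the error.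
  have hmom : ∀ s ∈ Icc (0 : ℝ) 1, ‖(d s).2 - (d 0).2‖ ≤ κ * C := by
    intro s hs
    have h1 := (convex_Icc (0 : ℝ) 1).norm_image_sub_le_of_norm_hasDerivWithin_le
      (f := fun s => (d s).2) (f' := fun s => (e s).2) (C := κ * C)
      (fun s hs => by simpa using hasDerivWithinAt_snd (hd' s hs))
      (fun s hs => (norm_snd_le _).trans (heC s hs)) (left_mem_Icc.2 zero_le_one) hs
    refine h1.trans (mul_le_of_le_one_right (by positivity) ?_)
    rw [sub_zero, Real.norm_of_nonneg hs.1]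
    exact hs.2
  have hpos := (convex_Icc (0 : ℝ) 1).norm_image_sub_le_of_norm_hasDerivWithin_le
      (f := fun s => (d s).1 - s • raise A a (d 0).2)
      (f' := fun s => raise A a ((d s).2 - (d 0).2) + (e s).1) (C := (B + 1) * (κ * C))
      (fun s hs => by
        have h1 := hasDerivWithinAt_fst (hd' s hs)
        have h2 := ((hasDerivAt_id s).smul_const (raise A a (d 0).2)).hasDerivWithinAt
          (s := Icc (0 : ℝ) 1)
        refine (h1.sub h2).congr_deriv ?_
        simp only [Prod.fst_add, one_smul, map_sub]
        abel)
      (fun s hs => by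
        calc ‖raise A a ((d s).2 - (d 0).2) + (e s).1‖
            ≤ B * (κ * C) + κ * C := by
              refine (norm_add_le _ _).trans (add_le_add ?_ ((norm_fst_le _).trans (heC s hs)))
              exact ((raise A a).le_opNorm _).trans (by gcongr; exact hmom s hs)
          _ = (B + 1) * (κ * C) := by ring)
      (left_mem_Icc.2 zero_le_one) (right_mem_Icc.2 zero_le_one)
  simpa [hd, hx, hx'] using hpos

/-- The exponential map at `a` is close to its linearization near `0`. -/
theorem IsAnalyticMetricOn.exists_exponential (hA : IsAnalyticMetricOn A U) (hU : IsOpen U)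
    (ha : a ∈ U) {κ : ℝ≥0} (hκ : 0 < κ) :
    ∃ r > 0, ∃ X P : (Fin n → ℝ) → ℝ → Fin n → ℝ,
      (∀ q ∈ Metric.ball (0 : Fin n → ℝ) r,
        IsGeodesicIn A U (X q) (P q) ∧ X q 0 = a ∧ P q 0 = q) ∧
      ApproximatesLinearOn (fun q => X q 1) (raise A a) (Metric.ball 0 r) κ := by
  set M : ℝ := (‖raise A a‖ + 1) * Real.exp (‖raise A a‖ + 1) with hM
  have hM0 : 0 < M := by positivity
  -- `M` is the constant of `IsGeodesicIn.norm_sub_le`, whose Grönwall step needs `κ' ≤ 1`.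
  set κ' : ℝ≥0 := min 1 (κ / M.toNNReal) with hκ'
  have hκ'0 : 0 < κ' := lt_min one_pos (div_pos hκ (by simpa using hM0))
  have hκM : M * κ' ≤ κ := by
    have h1 : (κ' : ℝ) ≤ κ / M := by
      have : κ' ≤ κ / M.toNNReal := min_le_right _ _
      simpa [hM0.le] using NNReal.coe_le_coe.2 this
    rw [le_div_iff₀ hM0] at h1
    linarith
  obtain ⟨S, hS, hSa⟩ := (hA.hasStrictFDerivAt_hamiltonField ha).approximates_deriv_on_nhds
    (Or.inr hκ'0)
  obtain ⟨ρ, hρ, hρS⟩ := Metric.nhds_basis_closedBall.mem_iff.1 hS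
  obtain ⟨δ, hδ, H⟩ := hA.exists_geodesic hU ha hρ
  choose! X P hX using H
  have hb : ∀ q ∈ Metric.ball (0 : Fin n → ℝ) δ, ‖q‖ ≤ δ := fun q hq => by
    rw [mem_ball_zero_iff] at hq
    exact hq.le
  refine ⟨δ, hδ, X, P, fun q hq => ⟨(hX q (hb q hq)).1, (hX q (hb q hq)).2.1,
    (hX q (hb q hq)).2.2.1⟩, fun q hq q' hq' => ?_⟩
  obtain ⟨h1, h2, h3, h4⟩ := hX q (hb q hq)
  obtain ⟨h1', h2', h3', h4'⟩ := hX q' (hb q' hq')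
  have := IsGeodesicIn.norm_sub_le hA (min_le_left _ _) hSa h1 h1' h2 h2'
    (fun s hs => hρS (h4 s hs)) (fun s hs => hρS (h4' s hs))
  rw [h3, h3'] at this
  refine this.trans ?_
  calc _ = M * κ' * ‖q - q'‖ := by rw [hM]; ring
    _ ≤ κ * ‖q - q'‖ := by gcongr

/-- The inverse metric as a linear equivalence. -/
theorem IsAnalyticMetricOn.exists_equiv (hA : IsAnalyticMetricOn A U) (ha : a ∈ U) :
    ∃ e : (Fin n → ℝ) ≃L[ℝ] (Fin n → ℝ), (e : (Fin n → ℝ) →L[ℝ] (Fin n → ℝ)) = raise A a := by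
  refine ⟨ContinuousLinearEquiv.equivOfInverse (raise A a)
    (LinearMap.toContinuousLinearMap (Matrix.mulVecLin (A a))) (fun p => ?_) (fun v => ?_), ?_⟩
  · simpa using hA.mulVec_raise ha p
  · simpa using hA.raise_mulVec ha v
  · ext; rfl

/-- Normal neighbourhoods exist. -/
theorem IsAnalyticMetricOn.exists_isNormalNhd (hA : IsAnalyticMetricOn A U) (hU : IsOpen U)
    (ha : a ∈ U) : ∃ W, W ⊆ U ∧ IsNormalNhd A a W := by
  obtain ⟨e, he⟩ := hA.exists_equiv ha
  -- The first alternative covers the zero space, where the inverse has norm zero.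
  obtain ⟨κ, hκ, hκe⟩ : ∃ κ : ℝ≥0, 0 < κ ∧ (Subsingleton (Fin n → ℝ) ∨
      κ < ‖(e.symm : (Fin n → ℝ) →L[ℝ] (Fin n → ℝ))‖₊⁻¹) := by
    rcases e.subsingleton_or_nnnorm_symm_pos with h | h
    · exact ⟨1, one_pos, Or.inl h⟩
    · obtain ⟨κ, h0, h1⟩ := exists_between (inv_pos.2 h)
      exact ⟨κ, h0, Or.inr h1⟩
  obtain ⟨r, hr, X, P, hX, happ⟩ := hA.exists_exponential hU ha hκ
  rw [← he] at happ
  set Φ := happ.toOpenPartialHomeomorph (fun q => X q 1) (Metric.ball 0 r) hκe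
    Metric.isOpen_ball with hΦ
  have hinj := happ.injOn hκe
  have hanti := happ.antilipschitz hκe
  set W := (fun q => X q 1) '' Metric.ball 0 r with hW
  have hscale : ∀ q ∈ Metric.ball (0 : Fin n → ℝ) r, ∀ s ∈ Icc (0 : ℝ) 1,
      s • q ∈ Metric.ball (0 : Fin n → ℝ) r := by
    intro q hq s hs
    rw [mem_ball_zero_iff] at hq ⊢
    rw [norm_smul, Real.norm_of_nonneg hs.1]
    exact (mul_le_of_le_one_left (norm_nonneg _) hs.2).trans_lt hq
  -- By rescaling and uniqueness, `x s` is the exponential of `s • p 0`.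
  have hexp : ∀ x p : ℝ → Fin n → ℝ, IsGeodesicIn A U x p → x 0 = a → ∀ s ∈ Icc (0 : ℝ) 1,
      s • p 0 ∈ Metric.ball (0 : Fin n → ℝ) r → x s = X (s • p 0) 1 := by
    intro x p h hx s hs hsp
    have := (h.comp_mul hA hs).eqOn hA (hX _ hsp).1 (by simp [hx, (hX _ hsp).2.1])
      (by simp [(hX _ hsp).2.2]) 1 (right_mem_Icc.2 zero_le_one)
    simpa using this.1
  have hmemW : ∀ q ∈ Metric.ball (0 : Fin n → ℝ) r, ∀ s ∈ Icc (0 : ℝ) 1, X q s ∈ W := by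
    intro q hq s hs
    have hsq : s • P q 0 ∈ Metric.ball (0 : Fin n → ℝ) r := by
      rw [(hX q hq).2.2]
      exact hscale q hq s hs
    exact ⟨_, hsq, (hexp _ _ (hX q hq).1 (hX q hq).2.1 s hs hsq).symm⟩
  have hWU : W ⊆ U := by
    rintro _ ⟨q, hq, rfl⟩
    exact (hX q hq).1.mem 1 (right_mem_Icc.2 zero_le_one)
  have hsmall : ∀ x p : ℝ → Fin n → ℝ, IsGeodesicIn A W x p → x 0 = a →
      p 0 ∈ Metric.ball (0 : Fin n → ℝ) r := by
    intro x p h hx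
    -- Otherwise `s • p 0` reaches the sphere of radius `r` at a time `σ ≤ 1`. But `x σ ∈ W` is the
    -- exponential of some `q` in the open ball, and the antilipschitz bound forces `s • p 0 → q` as
    -- `s ↑ σ`, so `‖q‖ = r`.
    by_contra hp
    rw [mem_ball_zero_iff, not_lt] at hp
    have hp0 : 0 < ‖p 0‖ := hr.trans_le hp
    set σ : ℝ := r / ‖p 0‖ with hσ
    have hσ0 : 0 < σ := by positivity
    have hσ1 : σ ≤ 1 := (div_le_one hp0).2 hp
    have hσp : σ * ‖p 0‖ = r := div_mul_cancel₀ _ hp0.ne'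
    obtain ⟨q, hq, hqx⟩ := h.mem σ ⟨hσ0.le, hσ1⟩
    have hsb : ∀ s ∈ Ico (0 : ℝ) σ, s • p 0 ∈ Metric.ball (0 : Fin n → ℝ) r := by
      intro s hs
      rw [mem_ball_zero_iff, norm_smul, Real.norm_of_nonneg hs.1, ← hσp]
      exact mul_lt_mul_of_pos_right hs.2 hp0
    have hnear : ∀ s ∈ Ico (0 : ℝ) σ, dist (s • p 0) q ≤
        ((‖(e.symm : (Fin n → ℝ) →L[ℝ] (Fin n → ℝ))‖₊⁻¹ - κ)⁻¹ : ℝ≥0) * dist (x s) (x σ) := by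
      intro s hs
      have h1 := hanti.le_mul_dist ⟨_, hsb s hs⟩ ⟨q, hq⟩
      rw [hexp x p (h.mono hWU) hx s ⟨hs.1, hs.2.le.trans hσ1⟩ (hsb s hs), ← hqx]
      exact h1
    have hne : (𝓝[Ico 0 σ] σ).NeBot := by
      rw [← mem_closure_iff_nhdsWithin_neBot, closure_Ico hσ0.ne]
      exact right_mem_Icc.2 hσ0.le
    have hl1 : Tendsto (fun s : ℝ => dist (s • p 0) q) (𝓝[Ico 0 σ] σ) (𝓝 (dist (σ • p 0) q)) := by
      have : Continuous fun s : ℝ => dist (s • p 0) q := by fun_prop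
      exact this.continuousWithinAt
    have hl2 : Tendsto (fun s : ℝ =>
        ((‖(e.symm : (Fin n → ℝ) →L[ℝ] (Fin n → ℝ))‖₊⁻¹ - κ)⁻¹ : ℝ≥0) * dist (x s) (x σ))
        (𝓝[Ico 0 σ] σ) (𝓝 (((‖(e.symm : (Fin n → ℝ) →L[ℝ] (Fin n → ℝ))‖₊⁻¹ - κ)⁻¹ : ℝ≥0) *
          dist (x σ) (x σ))) := by
      have h1 : Tendsto x (𝓝[Ico 0 σ] σ) (𝓝 (x σ)) :=
        (h.continuousOn_position σ ⟨hσ0.le, hσ1⟩).mono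
          (fun s hs => ⟨hs.1, hs.2.le.trans hσ1⟩)
      exact (h1.dist tendsto_const_nhds).const_mul _
    have hle := le_of_tendsto_of_tendsto hl1 hl2
      (eventually_nhdsWithin_of_forall fun s hs => hnear s hs)
    rw [dist_self, mul_zero] at hle
    have heq : σ • p 0 = q := dist_le_zero.1 hle
    rw [mem_ball_zero_iff, ← heq, norm_smul, Real.norm_of_nonneg hσ0.le, hσp] at hq
    exact lt_irrefl _ hq
  refine ⟨W, hWU, Φ.open_target, ?_, ?_, ?_⟩
  · have h0 : (0 : Fin n → ℝ) ∈ Metric.ball (0 : Fin n → ℝ) r := Metric.mem_ball_self hr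
    have := hmemW 0 h0 0 (left_mem_Icc.2 zero_le_one)
    rwa [(hX 0 h0).2.1] at this
  · rintro _ ⟨q, hq, rfl⟩
    exact ⟨X q, P q, (hX q hq).1.of_mem (hmemW q hq), (hX q hq).2.1, rfl⟩
  · intro x p x' p' h h' hx hx' h1
    have hone : (1 : ℝ) ∈ Icc (0 : ℝ) 1 := right_mem_Icc.2 zero_le_one
    have hp := hsmall x p h hx
    have hp' := hsmall x' p' h' hx'
    have e1 := hexp x p (h.mono hWU) hx 1 hone (by simpa using hp)
    have e2 := hexp x' p' (h'.mono hWU) hx' 1 hone (by simpa using hp')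
    rw [one_smul] at e1 e2
    have hpp : p 0 = p' 0 := hinj hp hp' (show X (p 0) 1 = X (p' 0) 1 by rw [← e1, ← e2, h1])
    exact fun s hs => ((h.mono hWU).eqOn hA (h'.mono hWU) (hx.trans hx'.symm) hpp s hs).1

/-! ### Gradient and Hessian -/

/-- The covector of partial derivatives. -/
noncomputable def grad (u : (Fin n → ℝ) → ℝ) (x : Fin n → ℝ) : Fin n → ℝ :=
  fun i => partialDeriv i u x

theorem apply_eq_dotProduct (L : (Fin n → ℝ) →ₗ[ℝ] ℝ) (v : Fin n → ℝ) :
    L v = (fun i => L (Pi.single i 1)) ⬝ᵥ v := by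
  conv_lhs => rw [pi_eq_sum_univ' v]
  simp only [map_sum, map_smul, smul_eq_mul, dotProduct]
  refine Finset.sum_congr rfl fun i _ => ?_
  rw [mul_comm]

theorem fderiv_eq_grad_dotProduct (x v : Fin n → ℝ) : fderiv ℝ u x v = grad u x ⬝ᵥ v :=
  apply_eq_dotProduct (fderiv ℝ u x : (Fin n → ℝ) →ₗ[ℝ] ℝ) v

theorem contDiffAt_grad {x : Fin n → ℝ} (hu : AnalyticAt ℝ u x) : ContDiffAt ℝ ∞ (grad u) x :=
  contDiffAt_pi.2 fun _ =>
    (hu.contDiffAt.fderiv_right (m := ∞) (n := ∞) (by simp)).clm_apply contDiffAt_const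

theorem hasFDerivAt_grad {x : Fin n → ℝ} (hu : AnalyticAt ℝ u x) :
    HasFDerivAt (grad u) (fderiv ℝ (grad u) x) x :=
  ((contDiffAt_grad hu).differentiableAt (by simp)).hasFDerivAt

theorem fderiv_grad_dotProduct {x : Fin n → ℝ} (hu : AnalyticAt ℝ u x) (v w : Fin n → ℝ) :
    fderiv ℝ (grad u) x v ⬝ᵥ w = fderiv ℝ (fderiv ℝ u) x v w := by
  have h1 : HasFDerivAt (fderiv ℝ u) (fderiv ℝ (fderiv ℝ u) x) x :=
    ((hu.contDiffAt.fderiv_right (m := ∞) (n := ∞) (by simp)).differentiableAt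
      (by simp)).hasFDerivAt
  have h2 := hasFDerivAt_pi'.1 (hasFDerivAt_grad hu)
  refine Eq.trans ?_ (apply_eq_dotProduct
    (fderiv ℝ (fderiv ℝ u) x v : (Fin n → ℝ) →ₗ[ℝ] ℝ) w).symm
  congr 1
  ext i
  have h3 := h1.clm_apply (hasFDerivAt_const (Pi.single i (1 : ℝ) : Fin n → ℝ) x)
  have h4 := (h2 i).unique h3
  simpa using congrArg (fun L => L v) h4

theorem fderiv_grad_symm {x : Fin n → ℝ} (hu : AnalyticAt ℝ u x) (v w : Fin n → ℝ) :
    fderiv ℝ (grad u) x v ⬝ᵥ w = fderiv ℝ (grad u) x w ⬝ᵥ v := by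
  rw [fderiv_grad_dotProduct hu, fderiv_grad_dotProduct hu]
  exact (hu.contDiffAt (n := ω)).isSymmSndFDerivAt (by simp) v w

theorem solvesOn_iff :
    SolvesOn A U u ↔ ∀ x ∈ U, raise A x (grad u x) ⬝ᵥ grad u x = 4 * u x := by
  refine forall₂_congr fun x _ => ?_
  rw [← charForm_eq]
  rfl

/-- The derivative of `x ↦ ∑ a^{jk}(x) q_j r_k` in terms of `force`. -/
theorem fderiv_raise_dotProduct (x v q r : Fin n → ℝ) :
    fderiv ℝ (raise A) x v q ⬝ᵥ r = force A x q r ⬝ᵥ v := by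
  let L : (Fin n → ℝ) →ₗ[ℝ] ℝ :=
    { toFun := fun v => fderiv ℝ (raise A) x v q ⬝ᵥ r
      map_add' := fun v w => by simp [add_dotProduct]
      map_smul' := fun t v => by simp [smul_dotProduct] }
  exact apply_eq_dotProduct L v

/-- The eikonal equation, differentiated once. -/
theorem SolvesOn.fderiv_grad_raise (hA : IsAnalyticMetricOn A U) (hU : IsOpen U)
    (hu : AnalyticOnNhd ℝ u U) (heq : SolvesOn A U u) {x : Fin n → ℝ} (hx : x ∈ U) :
    (2 : ℝ) • fderiv ℝ (grad u) x (raise A x (grad u x)) =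
      (4 : ℝ) • grad u x - force A x (grad u x) (grad u x) := by
  have hg := hasFDerivAt_grad (hu x hx)
  obtain ⟨L, hL, hLe⟩ := hasFDerivAt_dotProduct ((hA.hasFDerivAt_raise hx).clm_apply hg) hg
  have h4 : HasFDerivAt (fun y => 4 * u y) ((4 : ℝ) • fderiv ℝ u x) x :=
    (hu x hx).differentiableAt.hasFDerivAt.const_mul 4
  have hev : (fun y => raise A y (grad u y) ⬝ᵥ grad u y) =ᶠ[𝓝 x] fun y => 4 * u y := by
    filter_upwards [hU.mem_nhds hx] with y hy
    exact solvesOn_iff.1 heq y hy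
  have hLu := (hL.congr_of_eventuallyEq hev.symm).unique h4
  ext i
  have h5 := hLe (Pi.single i 1)
  rw [hLu] at h5
  -- Symmetry of the metric and of the Hessian makes the two product-rule terms equal, hence the
  -- factor `2`.
  have h6 : raise A x (fderiv ℝ (grad u) x (Pi.single i 1)) ⬝ᵥ grad u x =
      fderiv ℝ (grad u) x (raise A x (grad u x)) i := by
    rw [hA.raise_symm hx, dotProduct_comm, fderiv_grad_symm (hu x hx)]
    simp
  have h7 : raise A x (grad u x) ⬝ᵥ fderiv ℝ (grad u) x (Pi.single i 1) =
      fderiv ℝ (grad u) x (raise A x (grad u x)) i := by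
    rw [← h6, hA.raise_symm hx]
  have h8 : fderiv ℝ (raise A) x (Pi.single i 1) (grad u x) ⬝ᵥ grad u x =
      force A x (grad u x) (grad u x) i := rfl
  have h9 : fderiv ℝ u x (Pi.single i 1) = grad u x i := rfl
  simp only [add_apply, ContinuousLinearMap.comp_apply,
    ContinuousLinearMap.flip_apply, add_dotProduct, h6, h7, h8, h9, smul_apply,
    smul_eq_mul] at h5
  simp only [Pi.smul_apply, Pi.sub_apply, smul_eq_mul]
  linarith

/-! ### Propagation along geodesics -/

/-- Differentiability gives the bound near `0`; for `s ≥ δ` a uniform bound `C` is at most `(C / δ)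
s`. It supplies the `O(s)` coefficients of the singular equation. -/
theorem exists_norm_le_mul_of_hasDerivWithinAt {F : Type*} [NormedAddCommGroup F]
    [NormedSpace ℝ F] {f : ℝ → F} {f' : F} (hf : ContinuousOn f (Icc 0 1)) (h0 : f 0 = 0)
    (hf' : HasDerivWithinAt f f' (Icc 0 1) 0) :
    ∃ L, 0 ≤ L ∧ ∀ s ∈ Icc (0 : ℝ) 1, ‖f s‖ ≤ L * s := by
  obtain ⟨C, hC⟩ := isCompact_Icc.exists_bound_of_continuousOn hf
  have hC0 : 0 ≤ C := (norm_nonneg _).trans (hC 0 (left_mem_Icc.2 zero_le_one))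
  obtain ⟨c, hc⟩ := hf'.differentiableWithinAt.isBigO_sub.bound
  obtain ⟨δ, hδ, hδc⟩ := Metric.mem_nhdsWithin_iff.1 hc
  refine ⟨max c 0 + C / δ, by positivity, fun s hs => ?_⟩
  rcases lt_or_ge s δ with h | h
  · have hs' : s ∈ Metric.ball (0 : ℝ) δ ∩ Icc 0 1 := by
      refine ⟨?_, hs⟩
      rw [mem_ball_zero_iff, Real.norm_of_nonneg hs.1]
      exact h
    have h1 : ‖f s - f 0‖ ≤ c * ‖s - 0‖ := hδc hs'
    rw [h0, sub_zero, sub_zero, Real.norm_of_nonneg hs.1] at h1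
    refine h1.trans (mul_le_mul_of_nonneg_right ?_ hs.1)
    exact (le_max_left _ _).trans (le_add_of_nonneg_right (by positivity))
  · calc ‖f s‖ ≤ C := hC s hs
      _ = C / δ * δ := by field_simp
      _ ≤ C / δ * s := by gcongr
      _ ≤ (max c 0 + C / δ) * s :=
        mul_le_mul_of_nonneg_right (le_add_of_nonneg_left (le_max_right _ _)) hs.1

/-- A solution with the Taylor expansion of the world function at `a` has gradient `2 s p` along
every geodesic issuing from `a`. -/
theorem SolvesOn.grad_eq (hA : IsAnalyticMetricOn A U) (hU : IsOpen U)
    (hu : AnalyticOnNhd ℝ u U) (heq : SolvesOn A U u) (hg : grad u a = 0)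
    (hH : ∀ w, fderiv ℝ (grad u) a (raise A a w) = (2 : ℝ) • w)
    {x p : ℝ → Fin n → ℝ} (h : IsGeodesicIn A U x p) (hx : x 0 = a) :
    ∀ s ∈ Icc (0 : ℝ) 1, grad u (x s) = (2 * s) • p s := by
  have h0 : (0 : ℝ) ∈ Icc (0 : ℝ) 1 := left_mem_Icc.2 zero_le_one
  have ha : a ∈ U := hx ▸ h.mem 0 h0
  have hxc := h.continuousOn_position
  have hgc : ContinuousOn (fun s => grad u (x s)) (Icc 0 1) := fun s hs =>
    (contDiffAt_grad (hu _ (h.mem s hs))).continuousAt.comp_continuousWithinAt (hxc s hs)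
  obtain ⟨P, hP⟩ := isCompact_Icc.exists_bound_of_continuousOn h.continuousOn_momentum
  obtain ⟨B, hB⟩ := isCompact_Icc.exists_bound_of_continuousOn
    (f := fun s => ‖fderiv ℝ (raise A) (x s)‖) fun s hs =>
      (hA.continuousAt_norm_fderiv_raise (h.mem s hs)).comp_continuousWithinAt (hxc s hs)
  have hP0 : 0 ≤ P := (norm_nonneg _).trans (hP 0 h0)
  have hB0 : 0 ≤ B := (norm_nonneg _).trans (hB 0 h0)
  replace hB : ∀ s ∈ Icc (0 : ℝ) 1, ‖fderiv ℝ (raise A) (x s)‖ ≤ B := fun s hs =>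
    (le_abs_self _).trans (hB s hs)
  -- The deviation of the Hessian from twice the metric; it vanishes at `a`, hence is `O(s)` along
  -- the geodesic.
  set M : (Fin n → ℝ) → (Fin n → ℝ) →L[ℝ] (Fin n → ℝ) := fun y =>
    (fderiv ℝ (grad u) y).comp (raise A y) - (2 : ℝ) • ContinuousLinearMap.id ℝ (Fin n → ℝ) with hM
  have hMs : ∀ y ∈ U, ContDiffAt ℝ ∞ M y := fun y hy =>
    (((contDiffAt_grad (hu y hy)).fderiv_right (by simp)).clm_comp
      (hA.contDiffAt_raise hy)).sub contDiffAt_const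
  have hMa : M a = 0 := by
    ext1 w
    simp [hM, hH]
  obtain ⟨L₁, hL₁0, hL₁⟩ := exists_norm_le_mul_of_hasDerivWithinAt (f := fun s => M (x s))
    (fun s hs => (hMs _ (h.mem s hs)).continuousAt.comp_continuousWithinAt (hxc s hs))
    (by simp [hx, hMa])
    (((hMs _ (h.mem 0 h0)).differentiableAt (by simp)).hasFDerivAt.comp_hasDerivWithinAt 0
      (h.hasDerivWithinAt_position h0))
  have hgd : ∀ s ∈ Icc (0 : ℝ) 1, HasDerivWithinAt (fun s => grad u (x s))
      (fderiv ℝ (grad u) (x s) (raise A (x s) (p s))) (Icc 0 1) s := fun s hs =>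
    (hasFDerivAt_grad (hu _ (h.mem s hs))).comp_hasDerivWithinAt s
      (h.hasDerivWithinAt_position hs)
  obtain ⟨L₂, hL₂0, hL₂⟩ := exists_norm_le_mul_of_hasDerivWithinAt hgc (by simp [hx, hg])
    (hgd 0 h0)
  set w : ℝ → Fin n → ℝ := fun s => grad u (x s) - (2 * s) • p s with hw
  set w' : ℝ → Fin n → ℝ := fun s => fderiv ℝ (grad u) (x s) (raise A (x s) (p s)) -
    (2 : ℝ) • p s + s • force A (x s) (p s) (p s) with hw'
  have hwd : ∀ s ∈ Icc (0 : ℝ) 1, HasDerivWithinAt w (w' s) (Icc 0 1) s := by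
    intro s hs
    have h1 : HasDerivWithinAt (fun s : ℝ => 2 * s) 2 (Icc 0 1) s := by
      simpa using ((hasDerivAt_id s).const_mul (2 : ℝ)).hasDerivWithinAt (s := Icc (0 : ℝ) 1)
    refine ((hgd s hs).sub (h1.smul (h.hasDerivWithinAt_momentum hA hs))).congr_deriv ?_
    simp only [hw', smul_smul]
    rw [show (2 * s * -(1 / 2) : ℝ) = -s by ring, neg_smul]
    abel
  -- Multiplying by `2 s` lets `2 s p` be replaced by `grad u - w`; the terms free of `w` cancel by
  -- the differentiated eikonal equation.
  have hkey : ∀ s ∈ Icc (0 : ℝ) 1, (2 * s) • w' s =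
      -(M (x s) (w s)) - (1 / 2 : ℝ) • force A (x s) (w s) ((2 * s) • p s) -
        (1 / 2 : ℝ) • force A (x s) (grad u (x s)) (w s) := by
    intro s hs
    have h1 := SolvesOn.fderiv_grad_raise hA hU hu heq (h.mem s hs)
    have h2 : (2 * s) • p s = grad u (x s) - w s := by simp [hw]
    have h3 : (2 * s) • w' s = fderiv ℝ (grad u) (x s) (raise A (x s) ((2 * s) • p s)) -
        (2 : ℝ) • ((2 * s) • p s) +
        (1 / 2 : ℝ) • force A (x s) ((2 * s) • p s) ((2 * s) • p s) := by
      rw [force_smul_smul]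
      simp only [hw', map_smul, smul_add, smul_sub, smul_smul]
      ring_nf
    rw [h3, h2]
    have h4 : fderiv ℝ (grad u) (x s) (raise A (x s) (grad u (x s))) =
        (2 : ℝ) • grad u (x s) - (1 / 2 : ℝ) • force A (x s) (grad u (x s)) (grad u (x s)) := by
      have := congrArg (fun v => (1 / 2 : ℝ) • v) h1
      simp only [smul_smul, smul_sub] at this
      norm_num at this
      rw [this]
    simp only [hM, map_sub, h4, force_sub_left, force_sub_right, sub_apply,
      ContinuousLinearMap.comp_apply, smul_apply, ContinuousLinearMap.id_apply]
    module
  have hbound : ∀ s ∈ Ico (0 : ℝ) 1, ‖w' s‖ ≤ (L₁ + n * B * P + n * B * L₂) * ‖w s‖ := by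
    intro s hs
    have hs' := Ico_subset_Icc_self hs
    -- At `s = 0` the factor `2 s` cannot be divided out, but `w' 0 = 0` follows directly from the
    -- Hessian at `a`.
    rcases hs.1.eq_or_lt with rfl | hs0
    · have : w' 0 = 0 := by simp [hw', hx, hH]
      rw [this, norm_zero]
      positivity
    · have h1 : ‖(2 * s) • w' s‖ ≤ L₁ * s * ‖w s‖ + 1 / 2 * (n * B * ‖w s‖ * (2 * s * P)) +
          1 / 2 * (n * B * (L₂ * s) * ‖w s‖) := by
        rw [hkey s hs']
        refine (norm_sub_le _ _).trans (add_le_add ((norm_sub_le _ _).trans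
          (add_le_add ?_ ?_)) ?_)
        · rw [norm_neg]
          exact ((M (x s)).le_opNorm _).trans (by gcongr; exact hL₁ s hs')
        · rw [norm_smul, Real.norm_of_nonneg (by norm_num)]
          gcongr
          refine (norm_force_le _ _ _).trans ?_
          rw [norm_smul, Real.norm_of_nonneg (by linarith : 0 ≤ 2 * s)]
          gcongr
          exacts [hB s hs', hP s hs']
        · rw [norm_smul, Real.norm_of_nonneg (by norm_num)]
          gcongr
          refine (norm_force_le _ _ _).trans ?_
          gcongr
          exacts [hB s hs', hL₂ s hs']
      rw [norm_smul, Real.norm_of_nonneg (by linarith : 0 ≤ 2 * s)] at h1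
      have h2 : 0 ≤ n * B * L₂ * ‖w s‖ := by positivity
      have h3 : 0 ≤ n * B * P * ‖w s‖ := by positivity
      have h4 : 0 ≤ L₁ * ‖w s‖ := by positivity
      have h5 : s * (2 * ‖w' s‖) ≤
          s * (2 * ((L₁ + n * B * P + n * B * L₂) * ‖w s‖)) := by nlinarith
      linarith [le_of_mul_le_mul_left h5 hs0]
  have hw0 := eq_zero_of_abs_deriv_le_mul_abs_self_of_eq_zero_right
    (fun s hs => (hwd s hs).continuousWithinAt)
    (fun s hs => hasDerivWithinAt_Ici_of_Icc (hwd s (Ico_subset_Icc_self hs)) hs)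
    (by simp [hw, hx, hg]) hbound
  exact fun s hs => sub_eq_zero.1 (hw0 s hs)

/-- The characteristic form is constant along a geodesic. -/
theorem IsGeodesicIn.charForm_eq_charForm_zero (hA : IsAnalyticMetricOn A U)
    {x p : ℝ → Fin n → ℝ} (h : IsGeodesicIn A U x p) {s : ℝ} (hs : s ∈ Icc (0 : ℝ) 1) :
    charForm A (x s) (p s) = charForm A (x 0) (p 0) := by
  have hd : ∀ s ∈ Icc (0 : ℝ) 1,
      HasDerivWithinAt (fun s => charForm A (x s) (p s)) 0 (Icc 0 1) s := by
    intro s hs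
    simp only [charForm_eq]
    have h1 := (hA.hasFDerivAt_raise (h.mem s hs)).comp_hasDerivWithinAt s
      (h.hasDerivWithinAt_position hs)
    have h2 := h.hasDerivWithinAt_momentum hA hs
    refine (hasDerivWithinAt_dotProduct (h1.clm_apply h2) h2).congr_deriv ?_
    simp only [Function.comp_apply]
    rw [add_dotProduct, fderiv_raise_dotProduct, hA.raise_symm (h.mem s hs)]
    simp only [dotProduct_smul, smul_eq_mul]
    rw [dotProduct_comm (force A (x s) (p s) (p s))]
    ring
  have := (convex_Icc (0 : ℝ) 1).norm_image_sub_le_of_norm_hasDerivWithin_le (C := 0) hd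
    (by simp) (left_mem_Icc.2 zero_le_one) hs
  rw [zero_mul] at this
  exact sub_eq_zero.1 (norm_le_zero_iff.1 this)

/-- Both integrands are constant, and at most one of the two square roots is nonzero, according to
the sign of the conserved form. -/
theorem IsGeodesicIn.squaredLength_eq (hA : IsAnalyticMetricOn A U)
    {x p : ℝ → Fin n → ℝ} (h : IsGeodesicIn A U x p) :
    squaredLength A x = charForm A (x 0) (p 0) := by
  have hQ : ∀ t ∈ Icc (0 : ℝ) 1,
      Q A (x t) (derivWithin x (Icc 0 1) t) = charForm A (x 0) (p 0) := by
    intro t ht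
    rw [(h.hasDerivWithinAt_position ht).derivWithin (uniqueDiffOn_Icc zero_lt_one t ht),
      hA.Q_raise (h.mem t ht), h.charForm_eq_charForm_zero hA ht]
  have hI : ∀ φ : ℝ → ℝ, ∫ t in (0 : ℝ)..1, φ (Q A (x t) (derivWithin x (Icc 0 1) t)) =
      φ (charForm A (x 0) (p 0)) := by
    intro φ
    rw [intervalIntegral.integral_congr (g := fun _ => φ (charForm A (x 0) (p 0)))]
    · simp
    · intro t ht
      rw [uIcc_of_le zero_le_one] at ht
      simp only [hQ t ht]
  rw [squaredLength, hI (fun q => √q), hI (fun q => √(-q))]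
  rcases le_total 0 (charForm A (x 0) (p 0)) with hc | hc
  · rw [Real.sq_sqrt hc, Real.sqrt_eq_zero_of_nonpos (by linarith)]
    ring
  · rw [Real.sqrt_eq_zero_of_nonpos hc, Real.sq_sqrt (by linarith)]
    ring

/-- A solution with the Taylor expansion of the world function at `a` is the squared length of
geodesics issuing from `a`. -/
theorem SolvesOn.eq_squaredLength (hA : IsAnalyticMetricOn A U) (hU : IsOpen U)
    (hu : AnalyticOnNhd ℝ u U) (heq : SolvesOn A U u) (hg : grad u a = 0)
    (hH : ∀ w, fderiv ℝ (grad u) a (raise A a w) = (2 : ℝ) • w)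
    {x p : ℝ → Fin n → ℝ} (h : IsGeodesicIn A U x p) (hx : x 0 = a) :
    u (x 1) = squaredLength A x := by
  have h1 : (1 : ℝ) ∈ Icc (0 : ℝ) 1 := right_mem_Icc.2 zero_le_one
  have h2 := solvesOn_iff.1 heq _ (h.mem 1 h1)
  rw [SolvesOn.grad_eq hA hU hu heq hg hH h hx 1 h1, map_smul, smul_dotProduct, dotProduct_smul,
    ← charForm_eq, h.charForm_eq_charForm_zero hA h1, ← h.squaredLength_eq hA] at h2
  simp only [smul_eq_mul] at h2
  linarith

/-! ### The profile of the solutions which are not analytic -/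

theorem hasDerivAt_max_sq (r : ℝ) : HasDerivAt (fun r : ℝ => max r 0 ^ 2) (2 * max r 0) r := by
  rcases lt_trichotomy r 0 with h | rfl | h
  · rw [max_eq_right h.le, mul_zero]
    refine (hasDerivAt_const r (0 : ℝ)).congr_of_eventuallyEq ?_
    filter_upwards [Iio_mem_nhds h] with t ht
    rw [max_eq_right (le_of_lt ht)]
    norm_num
  · have h1 : (fun r : ℝ => max r 0 ^ 2) =O[𝓝 0] fun r => ‖r - 0‖ ^ 2 := by
      refine Asymptotics.IsBigO.of_bound 1 (Eventually.of_forall fun t => ?_)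
      rw [one_mul, sub_zero, norm_pow, norm_pow, norm_norm]
      have : ‖max t 0‖ ≤ ‖t‖ := by
        rw [Real.norm_of_nonneg (le_max_right _ _)]
        exact max_le (le_abs_self t) (abs_nonneg t)
      gcongr
    have h2 := (h1.hasFDerivAt one_lt_two).hasDerivAt
    simpa using h2
  · rw [max_eq_left h.le]
    have h1 : HasDerivAt (fun r : ℝ => r ^ 2) (2 * r) r := by simpa using hasDerivAt_pow 2 r
    refine h1.congr_of_eventuallyEq ?_
    filter_upwards [Ioi_mem_nhds h] with t ht
    rw [max_eq_left (le_of_lt ht)]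

/-- The function `s ↦ ((√s - c)₊)²`. -/
noncomputable def profile (c s : ℝ) : ℝ :=
  max (√s - c) 0 ^ 2

theorem sqrt_lt_of_lt_sq {c s : ℝ} (hc : 0 < c) (hs : s < c ^ 2) : √s < c :=
  (Real.sqrt_lt' hc).2 hs

theorem hasDerivAt_profile {c : ℝ} (hc : 0 < c) (s : ℝ) :
    HasDerivAt (profile c) (max (√s - c) 0 / √s) s := by
  rcases lt_or_ge s (c ^ 2) with h | h
  · rw [max_eq_right (by linarith [sqrt_lt_of_lt_sq hc h]), zero_div]
    refine (hasDerivAt_const s (0 : ℝ)).congr_of_eventuallyEq ?_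
    filter_upwards [Iio_mem_nhds h] with t ht
    rw [profile, max_eq_right (by linarith [sqrt_lt_of_lt_sq hc ht])]
    norm_num
  · have hs : 0 < s := (by positivity : 0 < c ^ 2).trans_le h
    have h1 := (hasDerivAt_max_sq (√s - c)).comp s ((Real.hasDerivAt_sqrt hs.ne').sub_const c)
    refine h1.congr_deriv ?_
    field_simp

/-- The singularity of `√` at `0` is hidden where the profile vanishes identically, and squaring the
positive part smooths the corner at `c ^ 2` to first order. -/
theorem contDiff_profile {c : ℝ} (hc : 0 < c) : ContDiff ℝ 1 (profile c) := by
  rw [contDiff_one_iff_deriv]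
  refine ⟨fun s => (hasDerivAt_profile hc s).differentiableAt, ?_⟩
  rw [show deriv (profile c) = fun s => max (√s - c) 0 / √s from
    funext fun s => (hasDerivAt_profile hc s).deriv]
  refine continuous_iff_continuousAt.2 fun s => ?_
  rcases lt_or_ge s (c ^ 2) with h | h
  · refine (continuousAt_const (y := (0 : ℝ))).congr ?_
    filter_upwards [Iio_mem_nhds h] with t ht
    rw [max_eq_right (by linarith [sqrt_lt_of_lt_sq hc ht]), zero_div]
  · have hs : 0 < s := (by positivity : 0 < c ^ 2).trans_le h
    have h1 : ContinuousAt (fun s => max (√s - c) 0) s := by fun_prop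
    exact h1.div (by fun_prop) (Real.sqrt_ne_zero'.2 hs)

/-- By the chain rule, `φ ∘ u` solves the eikonal equation along with `u` as soon as `s φ'(s)² =
φ(s)`. -/
theorem mul_deriv_profile_sq {c : ℝ} (hc : 0 < c) (s : ℝ) :
    s * (max (√s - c) 0 / √s) ^ 2 = profile c s := by
  rcases le_or_gt s 0 with h | h
  · rw [profile, Real.sqrt_eq_zero_of_nonpos h, max_eq_right (by linarith)]
    simp
  · rw [div_pow, Real.sq_sqrt h.le, profile]
    field_simp

theorem profile_eq_zero {c s : ℝ} (hc : 0 < c) (hs : s < c ^ 2) : profile c s = 0 := by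
  rw [profile, max_eq_right (by linarith [sqrt_lt_of_lt_sq hc hs])]
  norm_num

/-- The profile of a solution is again a solution. -/
theorem solvesOn_profile (hu : AnalyticOnNhd ℝ u U) (heq : SolvesOn A U u) {c σ : ℝ} (hc : 0 < c)
    (hσ : σ * σ = 1) : SolvesOn A U fun x => σ * profile c (σ * u x) := by
  intro x hx
  set d := max (√(σ * u x) - c) 0 / √(σ * u x) with hd
  have hpd : ∀ i, partialDeriv i (fun x => σ * profile c (σ * u x)) x =
      d * partialDeriv i u x := by
    intro i
    have h1 := (hasDerivAt_profile hc (σ * u x)).comp_hasFDerivAt x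
      ((hu x hx).differentiableAt.hasFDerivAt.const_mul σ)
    have h2 : fderiv ℝ (fun x => σ * profile c (σ * u x)) x = _ := (h1.const_mul σ).fderiv
    rw [partialDeriv, h2]
    simp only [smul_apply, smul_eq_mul, ← hd, partialDeriv]
    linear_combination (d * fderiv ℝ u x (Pi.single i 1)) * hσ
  have h3 : ∑ i, ∑ j, contra A x i j * (d * partialDeriv i u x) * (d * partialDeriv j u x) =
      d ^ 2 * ∑ i, ∑ j, contra A x i j * partialDeriv i u x * partialDeriv j u x := by
    simp only [Finset.mul_sum]
    exact Finset.sum_congr rfl fun i _ => Finset.sum_congr rfl fun j _ => by ring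
  simp only [hpd]
  rw [h3, heq x hx]
  have h4 := mul_deriv_profile_sq hc (σ * u x)
  rw [← hd] at h4
  rw [← h4]
  linear_combination (-(4 * u x * d ^ 2)) * hσ

/-- The solutions which are `C¹` but not analytic. -/
theorem SolvesOn.exists_nonanalytic (hU : IsOpen U) (ha : a ∈ U)
    (hu : AnalyticOnNhd ℝ u U) (heq : SolvesOn A U u) (hua : u a = 0)
    (hne : ∃ᶠ x in 𝓝 a, u x ≠ 0) {Z : Set (Fin n → ℝ)} (hZ : ∀ x ∈ Z, u x = 0) :
    ∃ f : ℕ → (Fin n → ℝ) → ℝ,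
      (∀ k, ContDiffOn ℝ 1 (f k) U ∧ SolvesOn A U (f k) ∧ (∀ x ∈ Z, f k x = 0) ∧
        ¬ AnalyticOnNhd ℝ (f k) U) ∧
      ∀ k l, k ≠ l → ¬ EqOn (f k) (f l) U := by
  obtain ⟨ρ, hρ, hρU⟩ := Metric.isOpen_iff.1 hU a ha
  -- Taking `b` in a ball around `a` provides a connected set for the identity theorem, as `U`
  -- itself may be disconnected.
  obtain ⟨b, hb, hbρ⟩ := (hne.and_eventually (Metric.ball_mem_nhds a hρ)).exists
  obtain ⟨σ, hσ, hσb⟩ : ∃ σ : ℝ, σ * σ = 1 ∧ 0 < σ * u b := by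
    rcases lt_or_gt_of_ne hb with h | h
    · exact ⟨-1, by norm_num, by linarith⟩
    · exact ⟨1, by norm_num, by linarith⟩
  set m := √(σ * u b) with hm
  have hm0 : 0 < m := Real.sqrt_pos.2 hσb
  -- The shift by `2` gives `c k < m` even for `k = 0`, so that no solution vanishes at `b`; the
  -- values there also tell the solutions apart.
  set c : ℕ → ℝ := fun k => m / (k + 2) with hcdef
  have hc : ∀ k, 0 < c k := fun k => by positivity
  have hcm : ∀ k, c k < m := fun k => by
    refine div_lt_self hm0 ?_
    have : (0 : ℝ) ≤ k := k.cast_nonneg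
    linarith
  have hfb : ∀ k, profile (c k) (σ * u b) = (m - c k) ^ 2 := fun k => by
    rw [profile, ← hm, max_eq_left (by linarith [hcm k])]
  have hσ0 : σ ≠ 0 := fun h => by simp [h] at hσ
  refine ⟨fun k x => σ * profile (c k) (σ * u x), fun k => ⟨?_, solvesOn_profile hu heq (hc k) hσ, ?_, ?_⟩,
    fun k l hkl h => ?_⟩
  · have hu1 : ContDiffOn ℝ 1 u U := fun x hx => (hu x hx).contDiffAt.contDiffWithinAt
    exact contDiffOn_const.mul ((contDiff_profile (hc k)).comp_contDiffOn
      (contDiffOn_const.mul hu1))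
  · intro x hx
    change σ * profile (c k) (σ * u x) = 0
    rw [hZ x hx, mul_zero, profile_eq_zero (hc k) (by have := hc k; positivity), mul_zero]
  · intro h
    -- The solution vanishes wherever `σ u < c k ^ 2`, hence near `a`, though not at `b`.
    have hev : (fun x => σ * profile (c k) (σ * u x)) =ᶠ[𝓝 a] 0 := by
      have hcont : ContinuousAt (fun x => σ * u x) a := (hu a ha).continuousAt.const_mul σ
      have : ∀ᶠ x in 𝓝 a, σ * u x < c k ^ 2 := by
        refine hcont.eventually_lt continuousAt_const ?_
        have := hc k
        rw [hua, mul_zero]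
        positivity
      filter_upwards [this] with x hx
      simp [profile_eq_zero (hc k) hx]
    have h0 := (h.mono hρU).eqOn_zero_of_preconnected_of_eventuallyEq_zero
      (convex_ball a ρ).isPreconnected (Metric.mem_ball_self hρ) hev hbρ
    simp only [hfb, Pi.zero_apply, mul_eq_zero, hσ0, false_or] at h0
    have := pow_pos (sub_pos.2 (hcm k)) 2
    linarith
  · have h1 : σ * profile (c k) (σ * u b) = σ * profile (c l) (σ * u b) := h (hρU hbρ)
    rw [hfb, hfb] at h1
    have h2 := mul_left_cancel₀ hσ0 h1
    have h3 : m - c k = m - c l :=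
      (sq_eq_sq₀ (sub_pos.2 (hcm k)).le (sub_pos.2 (hcm l)).le).1 h2
    have h4 : c k = c l := by linarith
    have h5 : ((k : ℝ) + 2) = l + 2 := by
      have hk : (0 : ℝ) < k + 2 := by positivity
      have hl : (0 : ℝ) < l + 2 := by positivity
      simp only [hcdef] at h4
      rw [div_eq_div_iff hk.ne' hl.ne'] at h4
      exact (mul_left_cancel₀ hm0.ne' h4).symm
    exact hkl (by exact_mod_cast add_right_cancel h5)

/-! ### Quadratic forms vanishing on the null cone of an indefinite form -/

/-- Two quadratic forms, one of which vanishes on the null cone of the other, are proportional on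
any pair of vectors of opposite causal character. -/
theorem mul_eq_mul_of_vanishes_on_null {n : ℕ} {S T : (Fin n → ℝ) →ₗ[ℝ] (Fin n → ℝ)}
    (hS : ∀ v w, S v ⬝ᵥ w = S w ⬝ᵥ v) (hT : ∀ v w, T v ⬝ᵥ w = T w ⬝ᵥ v)
    (hST : ∀ v, T v ⬝ᵥ v = 0 → S v ⬝ᵥ v = 0) {v w : Fin n → ℝ} (hv : T v ⬝ᵥ v < 0)
    (hw : 0 < T w ⬝ᵥ w) : (S v ⬝ᵥ v) * (T w ⬝ᵥ w) = (S w ⬝ᵥ w) * (T v ⬝ᵥ v) := by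
  have hexp : ∀ R : (Fin n → ℝ) →ₗ[ℝ] (Fin n → ℝ), (∀ v w, R v ⬝ᵥ w = R w ⬝ᵥ v) → ∀ t : ℝ,
      R (v + t • w) ⬝ᵥ (v + t • w) = (R w ⬝ᵥ w) * t ^ 2 + 2 * (R v ⬝ᵥ w) * t + R v ⬝ᵥ v := by
    intro R hR t
    simp only [map_add, map_smul, add_dotProduct, dotProduct_add, smul_dotProduct, dotProduct_smul,
      smul_eq_mul, hR w v]
    ring
  set α := T v ⬝ᵥ v with hα
  set β := T v ⬝ᵥ w with hβ
  set γ := T w ⬝ᵥ w with hγ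
  -- Opposite signs of `α` and `γ` make the line `v + t w` meet the null cone at two distinct
  -- parameters. The form of `S` vanishes at both, so its quadratic polynomial in `t` is
  -- proportional to that of `T`.
  have hdisc : 0 < β ^ 2 - α * γ := by nlinarith [mul_pos (neg_pos.2 hv) hw, sq_nonneg β]
  set d := √(β ^ 2 - α * γ) with hd
  have hd0 : 0 < d := Real.sqrt_pos.2 hdisc
  have hd2 : d ^ 2 = β ^ 2 - α * γ := Real.sq_sqrt hdisc.le
  have hroot : ∀ ε : ℝ, ε ^ 2 = 1 →
      (S w ⬝ᵥ w) * ((-β + ε * d) / γ) ^ 2 + 2 * (S v ⬝ᵥ w) * ((-β + ε * d) / γ) + S v ⬝ᵥ v = 0 := by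
    intro ε hε
    rw [← hexp S hS]
    apply hST
    rw [hexp T hT, ← hα, ← hβ, ← hγ]
    field_simp
    linear_combination d ^ 2 * hε + hd2
  have h1 := hroot 1 (by norm_num)
  have h2 := hroot (-1) (by norm_num)
  set s := S w ⬝ᵥ w
  set σ := S v ⬝ᵥ w
  set τ := S v ⬝ᵥ v
  have hγ0 : γ ≠ 0 := hw.ne'
  field_simp at h1 h2
  have h3 : d * (σ * γ - s * β) = 0 := by linear_combination (h1 - h2) / 4
  have h4 : σ * γ = s * β := by
    rcases mul_eq_zero.1 h3 with h | h
    · exact absurd h hd0.ne'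
    · linarith
  have h5 : γ * (τ * γ - s * α) = 0 := by
    linear_combination (h1 + h2) / 2 - s * hd2 + 2 * β * h4
  rcases mul_eq_zero.1 h5 with h | h
  · exact absurd h hγ0
  · linarith

/-- A quadratic form which vanishes on the null cone of an indefinite form is a multiple of it. -/
theorem exists_eq_smul_of_vanishes_on_null {n : ℕ} {S T : (Fin n → ℝ) →ₗ[ℝ] (Fin n → ℝ)}
    (hS : ∀ v w, S v ⬝ᵥ w = S w ⬝ᵥ v) (hT : ∀ v w, T v ⬝ᵥ w = T w ⬝ᵥ v)
    (hneg : ∃ v, T v ⬝ᵥ v < 0) (hpos : ∃ w, 0 < T w ⬝ᵥ w)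
    (hST : ∀ v, T v ⬝ᵥ v = 0 → S v ⬝ᵥ v = 0) : ∃ c : ℝ, ∀ v, S v = c • T v := by
  obtain ⟨v, hv⟩ := hneg
  obtain ⟨w, hw⟩ := hpos
  set c := (S w ⬝ᵥ w) / (T w ⬝ᵥ w) with hc
  have hw' : S w ⬝ᵥ w = c * (T w ⬝ᵥ w) := by rw [hc, div_mul_cancel₀ _ hw.ne']
  -- Negative vectors are compared with `w`, and positive ones afterwards with `v`, so one constant
  -- serves both.
  have hnegc : ∀ y, T y ⬝ᵥ y < 0 → S y ⬝ᵥ y = c * (T y ⬝ᵥ y) := by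
    intro y hy
    have := mul_eq_mul_of_vanishes_on_null hS hT hST hy hw
    rw [hw'] at this
    exact mul_right_cancel₀ hw.ne' (by linarith)
  have hquad : ∀ y, S y ⬝ᵥ y = c * (T y ⬝ᵥ y) := by
    intro y
    rcases lt_trichotomy (T y ⬝ᵥ y) 0 with h | h | h
    · exact hnegc y h
    · rw [h, hST y h, mul_zero]
    · have := mul_eq_mul_of_vanishes_on_null hS hT hST hv h
      rw [hnegc v hv] at this
      exact (mul_right_cancel₀ hv.ne (by linarith)).symm
  refine ⟨c, fun y => funext fun i => ?_⟩
  -- Polarization recovers the linear maps from the quadratic forms.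
  have h1 := hquad (y + Pi.single i 1)
  have h2 := hquad y
  have h3 := hquad (Pi.single i 1)
  simp only [map_add, add_dotProduct, dotProduct_add] at h1
  rw [hS (Pi.single i 1) y, hT (Pi.single i 1) y] at h1
  have h4 : S y ⬝ᵥ Pi.single i 1 = c * (T y ⬝ᵥ Pi.single i 1) := by linarith
  simpa using h4

/-! ### The second order Taylor expansion at the vertex -/

/-- A function vanishing on the conoid vanishes along all short bicharacteristics. -/
theorem IsAnalyticMetricOn.exists_null_geodesic (hA : IsAnalyticMetricOn A U) (hU : IsOpen U)
    (ha : a ∈ U) (hzero : ∀ x ∈ characteristicConoid A U a, u x = 0) {v : Fin n → ℝ}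
    (hv : Q A a v = 0) : ∃ ε > (0 : ℝ), ∃ x p : ℝ → Fin n → ℝ, IsGeodesicIn A U x p ∧ x 0 = a ∧
      raise A a (p 0) = ε • v ∧ ∀ s ∈ Icc (0 : ℝ) 1, u (x s) = 0 := by
  obtain ⟨δ, hδ, H⟩ := hA.exists_geodesic hU ha one_pos
  set q := Matrix.mulVec (A a) v with hq
  -- The `+ 1` allows `q = 0`.
  set ε := δ / (‖q‖ + 1) with hε
  have hε0 : 0 < ε := by positivity
  obtain ⟨x, p, h, hx, hp, -⟩ := H (ε • q) (by
    rw [norm_smul, Real.norm_of_nonneg hε0.le, hε, div_mul_eq_mul_div,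
      div_le_iff₀ (by positivity)]
    nlinarith [norm_nonneg q])
  have hr : raise A a (p 0) = ε • v := by rw [hp, map_smul, hq, hA.raise_mulVec ha]
  -- The conoid consists of endpoints at time one; `x s` is the endpoint of the geodesic rescaled by
  -- `s`.
  refine ⟨ε, hε0, x, p, h, hx, hr, fun s hs => hzero _
    ⟨_, _, h.comp_mul hA hs, by simp [hx], ?_, by simp⟩⟩
  rw [mul_zero, charForm_eq, map_smul, hr, hp, dotProduct_smul, dotProduct_smul, smul_dotProduct,
    smul_dotProduct, dotProduct_comm, hq, ← Q_eq, hv]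
  simp

theorem IsGeodesicIn.grad_dotProduct_eq_zero {x p : ℝ → Fin n → ℝ} (h : IsGeodesicIn A U x p)
    (hu : AnalyticOnNhd ℝ u U) (h0 : ∀ s ∈ Icc (0 : ℝ) 1, u (x s) = 0) {s : ℝ}
    (hs : s ∈ Icc (0 : ℝ) 1) : grad u (x s) ⬝ᵥ raise A (x s) (p s) = 0 := by
  rw [← fderiv_eq_grad_dotProduct]
  have h1 := (hu _ (h.mem s hs)).differentiableAt.hasFDerivAt.comp_hasDerivWithinAt s
    (h.hasDerivWithinAt_position hs)
  have h2 : HasDerivWithinAt (u ∘ x) 0 (Icc 0 1) s :=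
    (hasDerivWithinAt_const s (Icc (0 : ℝ) 1) (0 : ℝ)).congr (fun t ht => h0 t ht) (h0 s hs)
  exact (uniqueDiffOn_Icc zero_lt_one s hs).eq_deriv _ h1 h2

theorem grad_dotProduct_eq_zero_of_null (hA : IsAnalyticMetricOn A U) (hU : IsOpen U)
    (ha : a ∈ U) (hu : AnalyticOnNhd ℝ u U)
    (hzero : ∀ x ∈ characteristicConoid A U a, u x = 0) {v : Fin n → ℝ}
    (hv : Q A a v = 0) : grad u a ⬝ᵥ v = 0 := by
  obtain ⟨ε, hε, x, p, h, hx, hp, h0⟩ := hA.exists_null_geodesic hU ha hzero hv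
  have := h.grad_dotProduct_eq_zero hu h0 (left_mem_Icc.2 zero_le_one)
  rw [hx, hp, dotProduct_smul, smul_eq_mul, mul_eq_zero] at this
  exact this.resolve_left hε.ne'

/-- In the second derivative of `u` along the bicharacteristic at `a`, the acceleration term is
paired with `grad u a = 0`, leaving only the Hessian. -/
theorem hessian_dotProduct_eq_zero_of_null (hA : IsAnalyticMetricOn A U) (hU : IsOpen U)
    (ha : a ∈ U) (hu : AnalyticOnNhd ℝ u U)
    (hzero : ∀ x ∈ characteristicConoid A U a, u x = 0) (hg : grad u a = 0) {v : Fin n → ℝ}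
    (hv : Q A a v = 0) : fderiv ℝ (grad u) a v ⬝ᵥ v = 0 := by
  obtain ⟨ε, hε, x, p, h, hx, hp, h0⟩ := hA.exists_null_geodesic hU ha hzero hv
  have h01 : (0 : ℝ) ∈ Icc (0 : ℝ) 1 := left_mem_Icc.2 zero_le_one
  have h1 := (hasFDerivAt_grad (hu _ (h.mem 0 h01))).comp_hasDerivWithinAt 0
    (h.hasDerivWithinAt_position h01)
  have h2 := ((hA.hasFDerivAt_raise (h.mem 0 h01)).comp_hasDerivWithinAt 0
    (h.hasDerivWithinAt_position h01)).clm_apply (h.hasDerivWithinAt_momentum hA h01)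
  have h3 := hasDerivWithinAt_dotProduct h1 h2
  have h4 : HasDerivWithinAt (fun s => (grad u ∘ x) s ⬝ᵥ (raise A ∘ x) s (p s)) 0
      (Icc (0 : ℝ) 1) 0 :=
    (hasDerivWithinAt_const (0 : ℝ) (Icc (0 : ℝ) 1) (0 : ℝ)).congr
      (fun t ht => h.grad_dotProduct_eq_zero hu h0 ht) (h.grad_dotProduct_eq_zero hu h0 h01)
  have h5 := (uniqueDiffOn_Icc zero_lt_one (0 : ℝ) h01).eq_deriv _ h3 h4
  simp only [Function.comp_apply, hx, hg, hp, zero_dotProduct, add_zero, map_smul,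
    smul_dotProduct, dotProduct_smul, smul_eq_mul] at h5
  exact (mul_eq_zero.1 ((mul_eq_zero.1 h5).resolve_left hε.ne')).resolve_left hε.ne'

theorem IsAnalyticMetricOn.mulVecLin_symm (hA : IsAnalyticMetricOn A U) (ha : a ∈ U)
    (v w : Fin n → ℝ) : (A a).mulVecLin v ⬝ᵥ w = (A a).mulVecLin w ⬝ᵥ v :=
  dotProduct_mulVec_of_isSymm (hA.symm a ha) v w

/-- The form `(grad u a ⬝ᵥ v) ^ 2` is a multiple of the metric; being nonnegative while the metric
takes both signs, it is zero. -/
theorem grad_vertex_eq_zero (hA : IsAnalyticMetricOn A U) (hU : IsOpen U) (ha : a ∈ U)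
    (hind : IsIndefiniteAt A a) (hu : AnalyticOnNhd ℝ u U)
    (hzero : ∀ x ∈ characteristicConoid A U a, u x = 0) : grad u a = 0 := by
  set l := grad u a with hl
  let S : (Fin n → ℝ) →ₗ[ℝ] (Fin n → ℝ) :=
    { toFun := fun v => (l ⬝ᵥ v) • l
      map_add' := fun v w => by simp [dotProduct_add, add_smul]
      map_smul' := fun t v => by simp [dotProduct_smul, smul_smul] }
  have hS : ∀ v w, S v ⬝ᵥ w = (l ⬝ᵥ v) * (l ⬝ᵥ w) := fun v w => by
    change ((l ⬝ᵥ v) • l) ⬝ᵥ w = _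
    rw [smul_dotProduct, smul_eq_mul]
  obtain ⟨⟨v, hv⟩, ⟨w, hw⟩⟩ := hind
  rw [Q_eq] at hv hw
  obtain ⟨c, hc⟩ := exists_eq_smul_of_vanishes_on_null (S := S) (T := (A a).mulVecLin)
    (fun v w => by rw [hS, hS, mul_comm]) (hA.mulVecLin_symm ha) ⟨v, hv⟩ ⟨w, hw⟩ (fun y hy => by
      rw [hS, grad_dotProduct_eq_zero_of_null hA hU ha hu hzero (v := y) (by
        rw [Q_eq]; exact hy), mul_zero])
  have hsq : ∀ y, (l ⬝ᵥ y) * (l ⬝ᵥ y) = c * (Matrix.mulVec (A a) y ⬝ᵥ y) := fun y => by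
    rw [← hS, hc, smul_dotProduct, smul_eq_mul, Matrix.mulVecLin_apply]
  have hc0 : c = 0 := by
    have h1 := hsq v
    have h2 := hsq w
    have h3 := mul_self_nonneg (l ⬝ᵥ v)
    have h4 := mul_self_nonneg (l ⬝ᵥ w)
    rcases lt_trichotomy c 0 with h | h | h
    · nlinarith [mul_pos (neg_pos.2 h) hw]
    · exact h
    · nlinarith [mul_pos h (neg_pos.2 hv)]
  have := hsq l
  rw [hc0, zero_mul] at this
  exact dotProduct_self_eq_zero.1 (mul_self_eq_zero.1 this)

/-- The Hessian of `u` at the vertex is twice the metric. -/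
theorem hessian_vertex_raise (hA : IsAnalyticMetricOn A U) (hU : IsOpen U) (ha : a ∈ U)
    (hind : IsIndefiniteAt A a) (hu : AnalyticOnNhd ℝ u U)
    (hzero : ∀ x ∈ characteristicConoid A U a, u x = 0) (heq : SolvesOn A U u)
    (hne : ∃ᶠ x in 𝓝 a, u x ≠ 0) (w : Fin n → ℝ) :
    fderiv ℝ (grad u) a (raise A a w) = (2 : ℝ) • w := by
  have hg := grad_vertex_eq_zero hA hU ha hind hu hzero
  obtain ⟨c, hc⟩ := exists_eq_smul_of_vanishes_on_null
    (S := (fderiv ℝ (grad u) a : (Fin n → ℝ) →ₗ[ℝ] (Fin n → ℝ))) (T := (A a).mulVecLin)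
    (fun v w => fderiv_grad_symm (hu a ha) v w) (hA.mulVecLin_symm ha)
    (hind.1.imp fun v hv => by rwa [Q_eq] at hv) (hind.2.imp fun v hv => by rwa [Q_eq] at hv)
    (fun y hy => hessian_dotProduct_eq_zero_of_null hA hU ha hu hzero hg (by
      rw [Q_eq]; exact hy))
  have hcr : ∀ w, fderiv ℝ (grad u) a (raise A a w) = c • w := fun w => by
    have := hc (raise A a w)
    rwa [Matrix.mulVecLin_apply, hA.mulVec_raise ha] at this
  suffices h2 : c = 2 by rw [hcr, h2]
  by_contra hc2
  refine hne ?_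
  set M : (Fin n → ℝ) → (Fin n → ℝ) →L[ℝ] (Fin n → ℝ) := fun y =>
    (fderiv ℝ (grad u) y).comp (raise A y) - c • ContinuousLinearMap.id ℝ (Fin n → ℝ) with hM
  have hMc : ContinuousAt M a :=
    ((((contDiffAt_grad (hu a ha)).fderiv_right (m := ∞) (n := ∞) (by simp)).clm_comp
      (hA.contDiffAt_raise ha)).sub contDiffAt_const).continuousAt
  have hMa : M a = 0 := by
    ext1 w
    simp [hM, hcr]
  have hgc : ContinuousAt (grad u) a := (contDiffAt_grad (hu a ha)).continuousAt
  have hrc := hA.continuousAt_norm_fderiv_raise ha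
  -- The left side tends to `0` at `a`, so for `c ≠ 2` it cannot balance `(2c - 4) grad u` unless
  -- the gradient vanishes.
  have hsmall : ∀ᶠ y in 𝓝 a, 2 * ‖M y‖ + n * ‖fderiv ℝ (raise A) y‖ * ‖grad u y‖ <
      |2 * c - 4| := by
    have hcont : ContinuousAt (fun y => 2 * ‖M y‖ + n * ‖fderiv ℝ (raise A) y‖ * ‖grad u y‖) a :=
      (continuousAt_const.mul hMc.norm).add ((continuousAt_const.mul hrc).mul hgc.norm)
    refine hcont.eventually_lt continuousAt_const ?_
    rw [hMa, hg, norm_zero, norm_zero, mul_zero, mul_zero, add_zero, abs_pos]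
    intro h
    exact hc2 (by linarith)
  filter_upwards [hsmall, hU.mem_nhds ha] with y hy hyU
  have h1 := heq.fderiv_grad_raise hA hU hu hyU
  have h2 : (2 * c - 4) • grad u y =
      -((2 : ℝ) • M y (grad u y)) - force A y (grad u y) (grad u y) := by
    simp only [hM, sub_apply, ContinuousLinearMap.comp_apply, smul_apply,
      ContinuousLinearMap.id_apply, smul_sub, h1]
    module
  have h3 : |2 * c - 4| * ‖grad u y‖ ≤
      (2 * ‖M y‖ + n * ‖fderiv ℝ (raise A) y‖ * ‖grad u y‖) * ‖grad u y‖ := by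
    rw [← Real.norm_eq_abs, ← norm_smul, h2]
    refine (norm_sub_le _ _).trans ?_
    rw [norm_neg, norm_smul, Real.norm_of_nonneg (by norm_num : (0 : ℝ) ≤ 2), add_mul]
    refine add_le_add ?_ (norm_force_le _ _ _)
    rw [mul_assoc]
    gcongr
    exact (M y).le_opNorm _
  have h4 : grad u y = 0 := by
    by_contra h
    have := mul_lt_mul_of_pos_right hy (norm_pos_iff.2 h)
    linarith
  have h5 := solvesOn_iff.1 heq y hyU
  rw [h4, dotProduct_zero] at h5
  intro h
  exact h (by linarith)

end Conoid

theorem mainTheorem6 {n : ℕ} (A : (Fin n → ℝ) → Matrix (Fin n) (Fin n) ℝ)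
    (U : Set (Fin n → ℝ)) (a : Fin n → ℝ) (hU : IsOpen U) (ha : a ∈ U)
    (hA : Conoid.IsAnalyticMetricOn A U) (hind : Conoid.IsIndefiniteAt A a)
    (u : (Fin n → ℝ) → ℝ) (hu : AnalyticOnNhd ℝ u U)
    (hzero : ∀ x ∈ Conoid.characteristicConoid A U a, u x = 0)
    (heq : Conoid.SolvesOn A U u)
    (hne : ∃ᶠ x in nhds a, u x ≠ 0) :
    (∃ W, W ⊆ U ∧ Conoid.IsNormalNhd A a W) ∧
    (∀ W, W ⊆ U → Conoid.IsNormalNhd A a W → ∀ x ∈ W, u x = Conoid.worldFunction A W a x) ∧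
    (∃ f : ℕ → (Fin n → ℝ) → ℝ,
      (∀ k, ContDiffOn ℝ 1 (f k) U ∧ Conoid.SolvesOn A U (f k) ∧
        (∀ x ∈ Conoid.characteristicConoid A U a, f k x = 0) ∧ ¬ AnalyticOnNhd ℝ (f k) U) ∧
      ∀ k l, k ≠ l → ¬ Set.EqOn (f k) (f l) U) := by
  have ha0 : u a = 0 := by
    -- The zero vector is null, which places the vertex on its own conoid.
    obtain ⟨ε, -, x, p, -, hx, -, h0⟩ := hA.exists_null_geodesic hU ha hzero (v := 0) (by
      simp [Conoid.Q])
    exact hx ▸ h0 0 (Set.left_mem_Icc.2 zero_le_one)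
  refine ⟨hA.exists_isNormalNhd hU ha, fun W hWU hW y hy => ?_,
    heq.exists_nonanalytic hU ha hu ha0 hne hzero⟩
  have hex := hW.exists_geodesic y hy
  -- The length formula holds for every geodesic from `a` to `y`, so it applies to the chosen one.
  obtain ⟨p, h, hx, h1⟩ := hex.choose_spec
  rw [Conoid.worldFunction, dif_pos hex]
  have := heq.eq_squaredLength hA hU hu (Conoid.grad_vertex_eq_zero hA hU ha hind hu hzero)
    (Conoid.hessian_vertex_raise hA hU ha hind hu hzero heq hne) (h.mono hWU) hx
  rwa [h1] at this
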